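/- Let $m,n\ge 0$ be integers. Let $\mathbb{C}^{2m|2n}$ be the complex superspace with basis $v_r, v_{\bar r}$, where $r\in\{-m,\dots,-1\}\cup\{\tfrac12,\tfrac32,\dots,n-\tfrac12\}$, ordered increasingly, and $v_r,v_{\bar r}$ are even for integral $r$ and odd for half-integral $r$. It carries the supersymmetric bilinear form with $(v_r|v_s)=(v_{\bar r}|v_{\bar s})=0$ and $(v_r|v_{\bar s})=\delta_{rs}=(-1)^{|v_r||v_s|}(v_{\bar s}|v_r)$. Let $\mathfrak{osp}(2m|2n)$ be the Lie superalgebra of endomorphisms preserving this form (in the super sense). Let $E_r=E_{rr}-E_{\bar r\bar r}$ be the standard basis of its Cartan subalgebra and let $\epsilon_r$ be the dual basis. A weight is called integral if it lies in the $\mathbb{Z}$-span of the $\epsilon_r$. Let $\mathfrak b$ be the Borel subalgebra with positive roots $\pm\epsilon_r-\epsilon_s$ for $r<s$ and $-2\epsilon_s$ for half-integral $s$. For $m\ge 2$ and $n\ge 1$ this is the Borel subalgebra with simple roots $$-\epsilon_{-m}-\epsilon_{-m+1},\quad \epsilon_{-m}-\epsilon_{-m+1},\ \dots,\ \epsilon_{-2}-\epsilon_{-1},\quad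 \epsilon_{-1}-\epsilon_{1/2},\quad \epsilon_{1/2}-\epsilon_{3/2},\ \dots,\ \epsilon_{n-3/2}-\epsilon_{n-1/2}.$$ An irreducible $\mathbb{Z}/2$-graded $\mathfrak{osp}(2m|2n)$-module that is a highest weight module with respect to $\mathfrak b$ with integral highest weight is finite dimensional if and only if its highest weight is of the form $$\pm\max\{\lambda'_m-n,0\}\,\epsilon_{-m}-\sum_{j=1}^{m-1}\max\{\lambda'_j-n,0\}\,\epsilon_{-j}-\sum_{i=1}^{n}\lambda_{n-i+1}\,\epsilon_{i-1/2}$$ for one of the two signs and some $(n|m)$-hook partition $\lambda=(\lambda_1,\lambda_2,\dots)$, i.e. a partition with $\lambda_{n+1}\le m$. Here $\lambda'$ is the conjugate partition, and the first term is absent if $m=0$. -/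

import Mathlib

namespace OrthoSymplectic

open Matrix

/-- Labels of the coordinates `ε` on the Cartan subalgebra of `osp(2m|2n)`:
`inl j` (`j = 0, …, m-1`) stands for the label `-(j+1)`, and
`inr i` (`i = 0, …, n-1`) stands for the label `i + 1/2`. -/
abbrev Label (m n : ℕ) : Type := Fin m ⊕ Fin n

/-- Labels of the basis of the natural module: `(r, false)` is `v_r` and
`(r, true)` is the barred vector `v_{\bar r}`. -/
abbrev BasisIndex (m n : ℕ) : Type := Label m n × Bool

/-- Square matrices over `ℂ` in the basis above, i.e. linear endomorphisms of `ℂ^{2m|2n}`. -/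
abbrev Mat (m n : ℕ) : Type := Matrix (BasisIndex m n) (BasisIndex m n) ℂ

/-- The parity of `v_r` and `v_{\bar r}`: even for integer labels, odd for half-integer ones. -/
def labelParity {m n : ℕ} : Label m n → ZMod 2
  | Sum.inl _ => 0
  | Sum.inr _ => 1

/-- The parity of a basis vector of `ℂ^{2m|2n}`. -/
def parity {m n : ℕ} (i : BasisIndex m n) : ZMod 2 := labelParity i.1

/-- The sign `(-1)^{pq}` for `p, q ∈ ℤ/2`. -/
def superSign (p q : ZMod 2) : ℂ := (-1) ^ (p.val * q.val)

/-- Gram matrix of the supersymmetric bilinear form: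
`(v_r|v_s) = (v_{\bar r}|v_{\bar s}) = 0` and
`(v_r|v_{\bar s}) = δ_{rs} = (-1)^{|v_r||v_s|} (v_{\bar s}|v_r)`. -/
def gram (m n : ℕ) : Mat m n := fun i j =>
  if i.1 = j.1 then
    match i.2, j.2 with
    | false, true => 1
    | true, false => superSign (parity i) (parity j)
    | _, _ => 0
  else 0

/-- The super commutator `AB - (-1)^{pq} BA` of matrices of parities `p` and `q`. -/
def superComm {m n : ℕ} (p q : ZMod 2) (A B : Mat m n) : Mat m n :=
  A * B - superSign p q • (B * A)

/-- The parity `p` component of the Lie superalgebra `osp(2m|2n)`: the matrices `A` which are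
homogeneous of parity `p` and satisfy `(A v_i|v_j) + (-1)^{p|v_i|} (v_i|A v_j) = 0` on the basis.
The Lie superalgebra itself is the direct sum of the components for `p = 0, 1`. -/
def osp (m n : ℕ) (p : ZMod 2) : Submodule ℂ (Mat m n) where
  carrier := {A | (∀ i j, parity i ≠ p + parity j → A i j = 0) ∧
    ∀ i j, (Aᵀ * gram m n) i j + superSign p (parity i) * (gram m n * A) i j = 0}
  add_mem' := by
    rintro A B ⟨hA, hA'⟩ ⟨hB, hB'⟩
    refine ⟨fun i j h => by simp [hA i j h, hB i j h], fun i j => ?_⟩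
    have h1 := hA' i j
    have h2 := hB' i j
    simp only [Matrix.transpose_add, Matrix.add_mul, Matrix.mul_add, Matrix.add_apply]
    linear_combination h1 + h2
  zero_mem' := by simp
  smul_mem' := by
    rintro c A ⟨hA, hA'⟩
    refine ⟨fun i j h => by simp [hA i j h], fun i j => ?_⟩
    have h1 := hA' i j
    simp only [Matrix.transpose_smul, Matrix.smul_mul, Matrix.mul_smul, Matrix.smul_apply,
      smul_eq_mul]
    linear_combination c * h1

theorem superSign_add_left (p q r : ZMod 2) :
    superSign (p + q) r = superSign p r * superSign q r := by
  have h : ∀ p q r : ZMod 2, ((-1 : ℤ)) ^ ((p + q).val * r.val) =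
      (-1) ^ (p.val * r.val) * (-1) ^ (q.val * r.val) := by decide
  simp only [superSign]
  exact_mod_cast h p q r

theorem superSign_comm (p q : ZMod 2) : superSign p q = superSign q p := by
  simp only [superSign, Nat.mul_comm]

theorem superSign_mul_self (p q : ZMod 2) : superSign p q * superSign p q = 1 := by
  fin_cases p <;> fin_cases q <;> simp [superSign, ZMod.val]

/-- The diagonal matrix with entries `(-1)^{p|v_i|}`. -/
def signMat (m n : ℕ) (p : ZMod 2) : Mat m n := Matrix.diagonal fun i => superSign p (parity i)

theorem mem_osp_iff {m n : ℕ} {p : ZMod 2} {A : Mat m n} :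
    A ∈ osp m n p ↔ (∀ i j, parity i ≠ p + parity j → A i j = 0) ∧
      Aᵀ * gram m n = -(signMat m n p * (gram m n * A)) := by
  refine and_congr_right fun _ => ⟨fun h => ?_, fun h i j => ?_⟩
  · ext i j
    have := h i j
    simp only [signMat, Matrix.neg_apply, Matrix.diagonal_mul]
    linear_combination this
  · have := congrFun (congrFun h i) j
    simp only [signMat, Matrix.neg_apply, Matrix.diagonal_mul] at this
    linear_combination this

theorem signMat_mul_of_mem {m n : ℕ} {p : ZMod 2} (q : ZMod 2) {A : Mat m n}
    (hA : A ∈ osp m n p) : signMat m n q * A = superSign p q • (A * signMat m n q) := by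
  ext i j
  simp only [signMat, Matrix.diagonal_mul, Matrix.mul_diagonal, Matrix.smul_apply, smul_eq_mul]
  by_cases h : parity i = p + parity j
  · rw [h, superSign_comm q, superSign_add_left, superSign_comm q (parity j)]
    ring
  · rw [hA.1 i j h]; simp

theorem signMat_mul_gram (m n : ℕ) (q : ZMod 2) :
    signMat m n q * gram m n = gram m n * signMat m n q := by
  ext i j
  simp only [signMat, Matrix.diagonal_mul, Matrix.mul_diagonal]
  by_cases h : i.1 = j.1
  · have : parity i = parity j := by simp [parity, h]
    rw [this, mul_comm]
  · simp [gram, h]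

theorem signMat_add (m n : ℕ) (p q : ZMod 2) :
    signMat m n (p + q) = signMat m n p * signMat m n q := by
  simp [signMat, Matrix.diagonal_mul_diagonal, superSign_add_left]

theorem transpose_mul_gram {m n : ℕ} {p q : ZMod 2} {A B : Mat m n}
    (hA : A ∈ osp m n p) (hB : B ∈ osp m n q) :
    (A * B)ᵀ * gram m n =
      superSign p q • (signMat m n (p + q) * (gram m n * (B * A))) := by
  have hA2 := (mem_osp_iff.1 hA).2
  have hB2 := (mem_osp_iff.1 hB).2
  have hB3 := congrArg Matrix.transpose (signMat_mul_of_mem p hB)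
  have hS : ∀ r, (signMat m n r)ᵀ = signMat m n r := fun r => by simp [signMat]
  rw [Matrix.transpose_smul, Matrix.transpose_mul, Matrix.transpose_mul, hS] at hB3
  rw [Matrix.transpose_mul, Matrix.mul_assoc, hA2, Matrix.mul_neg, ← Matrix.mul_assoc, hB3,
    Matrix.smul_mul, ← Matrix.mul_assoc, Matrix.mul_assoc _ Bᵀ, hB2, signMat_add,
    superSign_comm q p]
  simp only [Matrix.mul_assoc, Matrix.mul_neg, Matrix.neg_mul, smul_neg, neg_neg]

theorem superComm_mem {m n : ℕ} {p q : ZMod 2} {A B : Mat m n}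
    (hA : A ∈ osp m n p) (hB : B ∈ osp m n q) : superComm p q A B ∈ osp m n (p + q) := by
  have key : ∀ {p q : ZMod 2} {A B : Mat m n}, A ∈ osp m n p → B ∈ osp m n q →
      ∀ i j, parity i ≠ p + q + parity j → (A * B) i j = 0 := by
    intro p q A B hA hB i j h
    rw [Matrix.mul_apply]
    refine Finset.sum_eq_zero fun k _ => ?_
    by_cases h1 : parity i = p + parity k
    · by_cases h2 : parity k = q + parity j
      · exact absurd (by rw [h1, h2, add_assoc]) h
      · rw [hB.1 k j h2, mul_zero]
    · rw [hA.1 i k h1, zero_mul]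
  refine mem_osp_iff.2 ⟨fun i j h => ?_, ?_⟩
  · have h' : parity i ≠ q + p + parity j := by rwa [add_comm q p]
    simp [superComm, key hA hB i j h, key hB hA i j h']
  · rw [superComm, Matrix.transpose_sub, Matrix.sub_mul, Matrix.transpose_smul, Matrix.smul_mul,
      transpose_mul_gram hA hB, transpose_mul_gram hB hA, add_comm q p, superSign_comm q p,
      smul_smul, superSign_mul_self, one_smul]
    simp only [Matrix.mul_sub, Matrix.mul_smul]
    abel

/-- The super bracket `osp_p × osp_q → osp_{p+q}`. -/
def bracket {m n : ℕ} {p q : ZMod 2} (x : osp m n p) (y : osp m n q) : osp m n (p + q) :=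
  ⟨superComm p q x y, superComm_mem x.2 y.2⟩

/-- A `ℤ/2`-graded module over the Lie superalgebra `osp(2m|2n)` on the complex vector space `V`. -/
structure SuperModule (m n : ℕ) (V : Type*) [AddCommGroup V] [Module ℂ V] where
  /-- the even (`0`) and odd (`1`) parts of `V` -/
  grade : ZMod 2 → Submodule ℂ V
  grade_internal : DirectSum.IsInternal grade
  /-- the action of the even and odd parts of `osp(2m|2n)` -/
  act : ∀ p : ZMod 2, osp m n p →ₗ[ℂ] Module.End ℂ V
  act_mem : ∀ (p q : ZMod 2) (x : osp m n p) (v : V), v ∈ grade q → act p x v ∈ grade (p + q)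
  act_bracket : ∀ (p q : ZMod 2) (x : osp m n p) (y : osp m n q),
    act (p + q) (bracket x y) = act p x * act q y - superSign p q • (act q y * act p x)

/-- `V` is irreducible: it is nonzero and has no graded submodules besides `0` and `V`. -/
def SuperModule.IsIrreducible {m n : ℕ} {V : Type*} [AddCommGroup V] [Module ℂ V]
    (M : SuperModule m n V) : Prop :=
  Nontrivial V ∧ ∀ U : Submodule ℂ V, U ≤ ⨆ p, U ⊓ M.grade p →
    (∀ (p : ZMod 2) (x : osp m n p), ∀ v ∈ U, M.act p x v ∈ U) → U = ⊥ ∨ U = ⊤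

/-- The matrix `E_r = E_{rr} - E_{\bar r \bar r}`. -/
def cartanMat {m n : ℕ} (r : Label m n) : Mat m n :=
  Matrix.diagonal fun i => if i.1 = r then (if i.2 = false then 1 else -1) else 0

theorem cartanMat_mem {m n : ℕ} (r : Label m n) : cartanMat r ∈ osp m n 0 := by
  refine ⟨fun i j h => ?_, fun i j => ?_⟩
  · have : i ≠ j := by rintro rfl; simp at h
    simp [cartanMat, this]
  · obtain ⟨i, b⟩ := i
    obtain ⟨j, c⟩ := j
    simp only [cartanMat, Matrix.diagonal_transpose, Matrix.diagonal_mul, Matrix.mul_diagonal]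
    by_cases h : i = j
    · subst h
      cases b <;> cases c <;> by_cases h : i = r <;> simp [gram, superSign, h]
    · simp [gram, h]

/-- The basis `E_r` of the standard Cartan subalgebra of `osp(2m|2n)`. -/
def cartan {m n : ℕ} (r : Label m n) : osp m n 0 := ⟨cartanMat r, cartanMat_mem r⟩

/-- A weight `∑_r μ_r ε_r`, where `ε_r` is the basis dual to `E_r`. -/
abbrev Weight (m n : ℕ) : Type := Label m n → ℂ

/-- The basis weight `ε_r`. -/
def eps {m n : ℕ} (r : Label m n) : Weight m n := Pi.single r 1

/-- The weight lies in the `ℤ`-span of the `ε_r`. -/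
def IsIntegral {m n : ℕ} (μ : Weight m n) : Prop := ∀ r, ∃ z : ℤ, μ r = z

/-- The order `-m < ⋯ < -1 < 1/2 < 3/2 < ⋯ < n - 1/2` of the labels. -/
def LabelLT {m n : ℕ} : Label m n → Label m n → Prop
  | Sum.inl j, Sum.inl k => k < j
  | Sum.inl _, Sum.inr _ => True
  | Sum.inr _, Sum.inl _ => False
  | Sum.inr i, Sum.inr k => i < k

/-- The positive roots `±ε_r - ε_s` (`r < s`) and `-2ε_s` (`s` half-integral). For `m ≥ 2` they
belong to the simple roots `-ε_{-m} - ε_{-m+1}`, `ε_{-m} - ε_{-m+1}`, …, `ε_{-2} - ε_{-1}`,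
`ε_{-1} - ε_{1/2}`, `ε_{1/2} - ε_{3/2}`, …, `ε_{n-3/2} - ε_{n-1/2}`. -/
inductive IsPositiveRoot {m n : ℕ} : Weight m n → Prop
  | sub (r s : Label m n) (h : LabelLT r s) : IsPositiveRoot (eps r - eps s)
  | neg (r s : Label m n) (h : LabelLT r s) : IsPositiveRoot (-eps r - eps s)
  | long (i : Fin n) : IsPositiveRoot (-(2 : ℂ) • eps (Sum.inr i))

/-- `x` is a root vector for `α`, i.e. `[E_r, x] = α(E_r) x` for all `r`. -/
def IsRootVector {m n : ℕ} {p : ZMod 2} (α : Weight m n) (x : osp m n p) : Prop :=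
  ∀ r, superComm 0 p (cartanMat r) x = α r • (x : Mat m n)

/-- `v` is a highest weight vector of weight `μ` with respect to the Borel subalgebra spanned by
the standard Cartan subalgebra and the root vectors of the positive roots. -/
def SuperModule.IsHighestWeightVector {m n : ℕ} {V : Type*} [AddCommGroup V] [Module ℂ V]
    (M : SuperModule m n V) (μ : Weight m n) (v : V) : Prop :=
  v ≠ 0 ∧ (∀ r, M.act 0 (cartan r) v = μ r • v) ∧
    ∀ (p : ZMod 2) (x : osp m n p) (α : Weight m n),
      IsPositiveRoot α → IsRootVector α x → M.act p x v = 0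

/-- `μ` is the highest weight of the irreducible module `M`. (In an irreducible module a highest
weight vector generates, so `M` is then a highest weight module of highest weight `μ`.) -/
def SuperModule.HasHighestWeight {m n : ℕ} {V : Type*} [AddCommGroup V] [Module ℂ V]
    (M : SuperModule m n V) (μ : Weight m n) : Prop :=
  ∃ v, M.IsHighestWeightVector μ v

/-- The partition `(lam_1, lam_2, …)` is an `(n|m)`-hook partition: `lam_{n+1} ≤ m`.
Rows and columns of Young diagrams are numbered from `0`: `lam.rowLen i` is the part `lam_{i+1}`
and `lam.colLen j` is the part with index `j + 1` of the conjugate partition. -/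
def IsHookPartition (n m : ℕ) (lam : YoungDiagram) : Prop := lam.rowLen n ≤ m

/-- The weight `s max{λ'_m - n, 0} ε_{-m} - ∑_{j=1}^{m-1} max{λ'_j - n, 0} ε_{-j}
- ∑_{i=1}^n λ_{n-i+1} ε_{i-1/2}` for a sign `s = ±1`. -/
def hookWeight (m n : ℕ) (s : ℤˣ) (lam : YoungDiagram) : Weight m n
  | Sum.inl j =>
      if (j : ℕ) + 1 = m then (((s : ℤ) * max ((lam.colLen j : ℤ) - n) 0 : ℤ) : ℂ)
      else ((-max ((lam.colLen j : ℤ) - n) 0 : ℤ) : ℂ)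
  | Sum.inr i => -(lam.rowLen (n - 1 - i) : ℂ)

end OrthoSymplectic

/-! Write the highest weight with coordinates -b_i at the half-integral labels and -ν_j at the label
-(j+1). Both directions pass through `IsDominant`: b is an increasing sequence of naturals, ν_j ≥
|ν_k| for j < k, and ν_j = 0 once j ≥ b_0. Take b in reverse as the first n rows and the |ν_j| as
columns below them: the last condition makes the two pieces fit into one Young diagram. Only the
last ν may be negative, whence the sign in the statement (`IsDominant.exists_hookWeight`,
`exists_isDominant_hookWeight`).

Necessity. sl₂ theory for the even positive roots gives everything except the hook condition. For
that, odd reflections carry the label 1/2 past -1, -2, …. Passing -(k+1) lowers the current value of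
b_0 by one, unless that value plus ν_k is zero, when the weight stays. If ν_{b_0} ≠ 0, the first b_0
+ 1 reflections all change the weight and the value becomes -1, although -2ε_{1/2} is still a
positive even root: a contradiction (`IsSingular.hook`).

Sufficiency. If the coroot of an even simple root has value N on the highest weight, the (N+1)-st
power of the lowering operator sends the highest weight vector to zero or to a singular vector of
smaller height, and irreducibility excludes the latter (`IsSingular.root_pow_eq_zero`). The root
-2ε_{1/2} becomes simple only after 1/2 has passed all integral labels; the hook condition keeps its
coroot value natural on the way (`IsSingular.exists_isSingular_ord_last`). Commutators spread local
nilpotency to all even root vectors (`LocNil.commutator`, `IsSingular.locNil_root`). Since squares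
of odd root vectors are half brackets, a PBW-type argument bounds the length of the words needed to
span V (`finiteDimensional_of_commutator`). -/

namespace OrthoSymplectic

open Matrix

set_option linter.unusedSimpArgs false

variable {m n : ℕ}

/-! ### Matrix entries of osp(2m|2n) and its root vectors -/

/-- The involution `v_r ↔ v_{\bar r}` on the labels of the basis. -/
def dual (i : BasisIndex m n) : BasisIndex m n := (i.1, !i.2)

@[simp] theorem dual_dual (i : BasisIndex m n) : dual (dual i) = i := by simp [dual]

@[simp] theorem parity_dual (i : BasisIndex m n) : parity (dual i) = parity i := rfl

@[simp] theorem dual_fst (i : BasisIndex m n) : (dual i).1 = i.1 := rfl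

@[simp] theorem dual_inj {i j : BasisIndex m n} : dual i = dual j ↔ i = j :=
  ⟨fun h => by simpa using congrArg dual h, fun h => h ▸ rfl⟩

theorem dual_ne (i : BasisIndex m n) : dual i ≠ i := by
  intro h
  have := congrArg Prod.snd h
  simp [dual] at this

theorem dual_eq_comm {i j : BasisIndex m n} : dual i = j ↔ i = dual j :=
  ⟨fun h => by simp [← h], fun h => by simp [h]⟩

theorem eq_or_eq_dual {i j : BasisIndex m n} (h : i.1 = j.1) : i = j ∨ i = dual j := by
  obtain ⟨i, b⟩ := i
  obtain ⟨j, c⟩ := j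
  obtain rfl : i = j := h
  cases b <;> cases c <;> simp [dual]

/-- The nonzero entry of the Gram matrix in a given row. -/
def gsign (i : BasisIndex m n) : ℂ := gram m n i (dual i)

theorem gram_apply (i j : BasisIndex m n) :
    gram m n i j = if j = dual i then gsign i else 0 := by
  split_ifs with h
  · rw [h, gsign]
  · obtain ⟨i, b⟩ := i
    obtain ⟨j, c⟩ := j
    by_cases hij : i = j
    · subst hij
      cases b <;> cases c <;> simp_all [gram, dual]
    · simp [gram, hij]

theorem superSign_eq (p q : ZMod 2) : superSign p q = if p = 1 ∧ q = 1 then -1 else 1 := by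
  have h : ∀ p q : ZMod 2, ((-1 : ℤ)) ^ (p.val * q.val) = if p = 1 ∧ q = 1 then -1 else 1 := by
    decide
  rw [superSign]
  exact_mod_cast h p q

theorem gsign_eq (i : BasisIndex m n) :
    gsign i = if i.2 = true then superSign (parity i) (parity i) else 1 := by
  obtain ⟨i, b⟩ := i
  cases b <;> simp [gsign, gram, dual, parity]

theorem gsign_mul_self (i : BasisIndex m n) : gsign i * gsign i = 1 := by
  rw [gsign_eq]
  split_ifs <;> simp [superSign_mul_self]

theorem gsign_dual (i : BasisIndex m n) :
    gsign (dual i) = superSign (parity i) (parity i) * gsign i := by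
  rw [gsign_eq, gsign_eq]
  obtain ⟨i, b⟩ := i
  cases b <;> simp [dual, parity, superSign_mul_self]

/-- Each row of the Gram matrix has a single nonzero entry ±1, in the dual column, so invariance of
the form is a relation between an entry and the one at the dual transposed position. -/
theorem mem_osp_iff_entries {p : ZMod 2} {A : Mat m n} :
    A ∈ osp m n p ↔ (∀ i j, parity i ≠ p + parity j → A i j = 0) ∧
      ∀ k l, A (dual k) (dual l) = -(superSign p (parity k) * gsign k * gsign l * A l k) := by
  refine and_congr_right fun _ => ?_
  have h : ∀ k l, (Aᵀ * gram m n) k (dual l) + superSign p (parity k) * (gram m n * A) k (dual l) =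
      A l k * gsign l + superSign p (parity k) * (gsign k * A (dual k) (dual l)) := by
    intro k l
    simp only [Matrix.mul_apply, gram_apply, Matrix.transpose_apply, dual_inj, mul_ite, ite_mul,
      mul_zero, zero_mul]
    simp [Finset.sum_ite_eq]
  refine ⟨fun H k l => ?_, fun H k l => ?_⟩
  · have h1 := h k l
    rw [H k (dual l)] at h1
    have h2 := superSign_mul_self p (parity k)
    have h3 := gsign_mul_self k
    linear_combination (-superSign p (parity k) * gsign k) * h1 - A (dual k) (dual l) * h2 -
      A (dual k) (dual l) * h3 * superSign p (parity k) * superSign p (parity k)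
  · obtain ⟨l, rfl⟩ : ∃ l', l = dual l' := ⟨dual l, by simp⟩
    rw [h k l, H k l]
    have h2 := superSign_mul_self p (parity k)
    have h3 := gsign_mul_self k
    linear_combination (-A l k * gsign l * gsign k * gsign k) * h2 - A l k * gsign l * h3

/-- The sign in front of the second matrix unit of a root vector. -/
def rootSign (p : ZMod 2) (a b : BasisIndex m n) : ℂ := superSign p (parity b) * gsign a * gsign b

/-- The projection of the matrix unit `E_{ab}` to the parity `p` part of `2 • osp(2m|2n)`. -/
noncomputable def rootMat (p : ZMod 2) (a b : BasisIndex m n) : Mat m n :=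
  if parity a = p + parity b then
    single a b 1 - rootSign p a b • single (dual b) (dual a) 1 else 0

theorem rootMat_of {p : ZMod 2} {a b : BasisIndex m n} (h : parity a = p + parity b) :
    rootMat p a b = single a b 1 - rootSign p a b • single (dual b) (dual a) 1 := if_pos h

theorem parity_comm {p : ZMod 2} {a b : BasisIndex m n} (h : parity a = p + parity b) :
    parity b = p + parity a := by
  rw [h, ← add_assoc, CharTwo.add_self_eq_zero, zero_add]

/-- Applying the relation between dual positions twice must return the original entry; this is the
required compatibility of signs. -/
theorem superSign_cocycle (p q : ZMod 2) : superSign p (p + q) * superSign (p + q) (p + q) *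
    (superSign q q * superSign p q) = 1 := by
  have h : ∀ p q : ZMod 2, ((-1 : ℤ)) ^ (p.val * (p + q).val) *
      (-1) ^ ((p + q).val * (p + q).val) * ((-1) ^ (q.val * q.val) * (-1) ^ (p.val * q.val)) =
      1 := by decide
  simp only [superSign]
  exact_mod_cast h p q

theorem rootMat_mem (p : ZMod 2) (a b : BasisIndex m n) : rootMat p a b ∈ osp m n p := by
  by_cases h : parity a = p + parity b
  swap
  · rw [rootMat, if_neg h]
    exact Submodule.zero_mem _
  rw [rootMat_of h, mem_osp_iff_entries]
  refine ⟨fun i j hij => ?_, fun k l => ?_⟩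
  · have h1 : ¬ (a = i ∧ b = j) := by
      rintro ⟨rfl, rfl⟩
      exact hij h
    have h2 : ¬ (dual b = i ∧ dual a = j) := by
      rintro ⟨rfl, rfl⟩
      exact hij (by simpa using parity_comm h)
    simp [h1, h2]
  · simp only [Matrix.sub_apply, Matrix.smul_apply, Matrix.single_apply, dual_inj, smul_eq_mul]
    have e1 : (a = dual k ∧ b = dual l) ↔ (dual b = l ∧ dual a = k) := by
      rw [dual_eq_comm, dual_eq_comm, and_comm]
    simp only [e1, and_comm (a := b = k)]
    by_cases h1 : a = l ∧ b = k
    · obtain ⟨rfl, rfl⟩ := h1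
      by_cases h2 : dual b = a ∧ dual a = b
      · obtain ⟨h2, -⟩ := h2
        subst h2
        simp [rootSign, gsign_dual]
        have h2 := superSign_mul_self p (parity b)
        have h3 := superSign_mul_self (parity b) (parity b)
        have hg := gsign_mul_self b
        linear_combination -h2 * superSign (parity b) (parity b) ^ 2 * gsign b ^ 4 -
          h3 * gsign b ^ 4 - hg * (gsign b * gsign b + 1)
      · simp [h2, rootSign]
        ring
    · by_cases h2 : dual b = l ∧ dual a = k
      · obtain ⟨rfl, rfl⟩ := h2
        have key : superSign p (parity a) * superSign (parity a) (parity a) *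
            (superSign (parity b) (parity b) * superSign p (parity b)) = 1 := by
          rw [h]
          exact superSign_cocycle p (parity b)
        simp only [h1, rootSign, gsign_dual, parity_dual]
        have ha := gsign_mul_self a
        have hb := gsign_mul_self b
        simp
        linear_combination -key - superSign p (parity a) * superSign (parity a) (parity a) *
            (superSign (parity b) (parity b) * superSign p (parity b)) * (ha * gsign b * gsign b + hb)
      · simp [h1, h2]

/-- The root vector `E_{ab} ∓ E_{b* a*}` (zero if its parity is not `p`). -/
noncomputable def root (p : ZMod 2) (a b : BasisIndex m n) : osp m n p :=
  ⟨rootMat p a b, rootMat_mem p a b⟩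

/-- By `mem_osp_iff_entries` the two matrix units of `root p a b` each reproduce the whole of `A`
when summed over all a, b, hence the factor 1/2. Claims about the action can therefore be checked on
root vectors. -/
theorem eq_sum_root {p : ZMod 2} (A : osp m n p) :
    A = (2⁻¹ : ℂ) • ∑ a, ∑ b, (A : Mat m n) a b • root p a b := by
  apply Subtype.ext
  obtain ⟨A, hA⟩ := A
  rw [mem_osp_iff_entries] at hA
  ext k l
  have h1 : ∀ a b, (A a b • rootMat p a b) k l =
      (if k = a then if l = b then A a b else 0 else 0) -
      (if dual k = b then if dual l = a then A a b * rootSign p a b else 0 else 0) := by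
    intro a b
    by_cases h : parity a = p + parity b
    · rw [rootMat_of h]
      simp only [Matrix.sub_apply, Matrix.smul_apply, Matrix.single_apply, smul_eq_mul]
      have e1 : dual b = k ↔ dual k = b := by rw [dual_eq_comm, eq_comm]
      have e2 : dual a = l ↔ dual l = a := by rw [dual_eq_comm, eq_comm]
      simp only [e1, e2, eq_comm (a := k), eq_comm (a := l)]
      by_cases c1 : a = k <;> by_cases c2 : b = l <;> by_cases c3 : dual k = b <;>
        by_cases c4 : dual l = a <;> simp [c1, c2, c3, c4, mul_sub, ite_and]
    · rw [hA.1 a b h]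
      simp
  simp only [Submodule.coe_smul, Submodule.coe_sum, Matrix.smul_apply, Matrix.sum_apply, root, h1,
    Finset.sum_sub_distrib]
  rw [Finset.sum_comm (γ := BasisIndex m n) (f := fun a b =>
    (if dual k = b then if dual l = a then A a b * rootSign p a b else 0 else 0))]
  have h2 := hA.2 (dual k) (dual l)
  simp only [dual_dual, parity_dual] at h2
  simp [rootSign]
  rw [h2]
  ring

/-! ### Weights, coroots and brackets of root vectors -/

theorem single_one_mul_single_one (a b c d : BasisIndex m n) :
    (single a b 1 : Mat m n) * single c d 1 = if b = c then single a d 1 else 0 := by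
  split_ifs with h
  · subst h
    simp
  · exact single_mul_single_of_ne _ _ _ _ h _

/-- The weight of a basis vector. -/
def wt (a : BasisIndex m n) : Weight m n := if a.2 = true then -eps a.1 else eps a.1

@[simp] theorem wt_dual (a : BasisIndex m n) : wt (dual a) = -wt a := by
  obtain ⟨a, b⟩ := a
  cases b <;> simp [wt, dual]

theorem cartanMat_eq (r : Label m n) : cartanMat r = diagonal fun i => wt i r := by
  rw [cartanMat]
  congr 1
  ext ⟨i, b⟩
  cases b <;> by_cases h : i = r <;> simp [wt, eps, Pi.single_apply, h, eq_comm (a := r)]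

@[simp] theorem superSign_zero_left (p : ZMod 2) : superSign 0 p = 1 := by simp [superSign]

@[simp] theorem superSign_one_one : superSign 1 1 = -1 := by simp [superSign_eq]

theorem superComm_cartanMat (p : ZMod 2) (r : Label m n) (A : Mat m n) (k l : BasisIndex m n) :
    superComm 0 p (cartanMat r) A k l = (wt k r - wt l r) * A k l := by
  simp [superComm, cartanMat_eq]
  ring

theorem superComm_cartanMat_rootMat (p : ZMod 2) (r : Label m n) (a b : BasisIndex m n) :
    superComm 0 p (cartanMat r) (rootMat p a b) = (wt a r - wt b r) • rootMat p a b := by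
  ext k l
  rw [superComm_cartanMat]
  by_cases h : parity a = p + parity b
  · rw [rootMat_of h]
    simp only [Matrix.smul_apply, Matrix.sub_apply, single_apply, smul_eq_mul]
    by_cases c1 : a = k ∧ b = l
    · obtain ⟨rfl, rfl⟩ := c1
      rfl
    · by_cases c2 : dual b = k ∧ dual a = l
      · obtain ⟨rfl, rfl⟩ := c2
        rw [if_neg c1, if_pos ⟨rfl, rfl⟩]
        simp only [wt_dual, Pi.neg_apply]
        ring
      · simp [c1, c2]
  · simp [rootMat, h]

/-- The Cartan element `E_{aa} - E_{a* a*}`. -/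
def coroot (a : BasisIndex m n) : osp m n 0 := (if a.2 = true then (-1 : ℂ) else 1) • cartan a.1

theorem coroot_coe (a : BasisIndex m n) :
    (coroot a : Mat m n) = single a a 1 - single (dual a) (dual a) 1 := by
  ext k l
  obtain ⟨a, b⟩ := a
  simp only [coroot, Submodule.coe_smul, Matrix.smul_apply, cartan, cartanMat, Matrix.sub_apply,
    single_apply, diagonal_apply]
  obtain ⟨k, c⟩ := k
  by_cases h : (k, c) = l
  · subst h
    cases b <;> cases c <;> by_cases h : k = a <;> simp [h, dual, eq_comm (a := a)]
  · simp [h]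
    have h1 : ¬ ((a, b) = (k, c) ∧ (a, b) = l) := fun h1 => h (h1.1 ▸ h1.2)
    have h2 : ¬ (dual (a, b) = (k, c) ∧ dual (a, b) = l) := fun h1 => h (h1.1 ▸ h1.2)
    simp [h2]
    exact fun h3 h4 h5 => h (by rw [← h5, h3, h4])

theorem rootSign_mul_comm {p : ZMod 2} {a b : BasisIndex m n} (h : parity a = p + parity b) :
    rootSign p a b * rootSign p b a = superSign p p := by
  have e : superSign p (parity a) = superSign p p * superSign p (parity b) := by
    rw [h, superSign_comm, superSign_add_left, superSign_comm (parity b)]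
  rw [rootSign, rootSign, e]
  have h1 := gsign_mul_self a
  have h2 := gsign_mul_self b
  have h3 := superSign_mul_self p (parity b)
  linear_combination superSign p p * (h1 * gsign b * gsign b * superSign p (parity b) ^ 2 +
    h2 * superSign p (parity b) ^ 2 + h3)

/-- For p = 1 the right side is the sum of the two coroots; its value on a weight decides whether an
odd reflection changes that weight. -/
theorem superComm_root_opposite {p : ZMod 2} {a b : BasisIndex m n}
    (h : parity a = p + parity b) (hab : a.1 ≠ b.1) :
    superComm p p (rootMat p a b) (rootMat p b a) =
      (coroot a : Mat m n) - superSign p p • (coroot b : Mat m n) := by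
  have h1 : a ≠ b := fun h => hab (h ▸ rfl)
  have h2 : a ≠ dual b := fun h => hab (h ▸ rfl)
  have h3 : dual a ≠ b := fun h => hab (h ▸ rfl)
  have h' := rootSign_mul_comm h
  have h'' : rootSign p b a * rootSign p a b = superSign p p := by rw [mul_comm, h']
  have hs := superSign_mul_self p p
  rw [rootMat_of h, rootMat_of (parity_comm h), coroot_coe, coroot_coe, superComm]
  simp only [Matrix.sub_mul, Matrix.mul_sub, Matrix.smul_mul, Matrix.mul_smul,
    single_one_mul_single_one, h1, h1.symm, h2, h2.symm, h3, h3.symm, if_true, if_false, smul_zero,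
    smul_smul, dual_inj, h', h'']
  simp only [smul_sub, sub_zero, zero_sub, smul_neg, sub_neg_eq_add, smul_add, smul_smul, hs,
    h', h'', one_smul]
  abel

/-- The two matrix units coincide here and, for an odd label, their signs agree. This doubling
explains the 4 in `superComm_root_long` and the 1/2 in `pairElt`. -/
theorem rootMat_dual_right {a : BasisIndex m n} (h : parity a = 1) :
    rootMat 0 a (dual a) = (2 : ℂ) • single a (dual a) 1 := by
  rw [rootMat_of (by simp)]
  have : rootSign 0 a (dual a) = -1 := by
    have h1 := gsign_mul_self a
    rw [rootSign, gsign_dual, h, superSign_zero_left, superSign_eq]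
    simp
    linear_combination h1
  rw [this, dual_dual, neg_one_smul, sub_neg_eq_add, two_smul]

theorem superComm_root_long {a : BasisIndex m n} (h : parity a = 1) :
    superComm 0 0 (rootMat 0 a (dual a)) (rootMat 0 (dual a) a) =
      (4 : ℂ) • (coroot a : Mat m n) := by
  have h2 := rootMat_dual_right (a := dual a) (by simpa using h)
  rw [dual_dual] at h2
  rw [rootMat_dual_right h, h2, coroot_coe, superComm]
  simp [single_one_mul_single_one, smul_smul, smul_sub]
  norm_num

theorem rootMat_dual_dual {a b : BasisIndex m n} (h : parity a = parity b) :
    rootMat 0 (dual b) (dual a) = -rootSign 0 a b • rootMat 0 a b := by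
  rw [rootMat_of (by simpa using h.symm), rootMat_of (by simpa using h)]
  have h1 : rootSign 0 (dual b) (dual a) = rootSign 0 a b := by
    simp [rootSign, gsign_dual, h]
    linear_combination gsign a * gsign b * superSign_mul_self (parity b) (parity b)
  have h2 : rootSign 0 a b * rootSign 0 a b = 1 := by
    simp [rootSign]
    linear_combination gsign a * gsign a * gsign_mul_self b + gsign_mul_self a
  rw [h1, dual_dual, dual_dual, smul_sub, smul_smul, neg_mul, h2]
  simp
  abel

theorem rootMat_mul_self {a b : BasisIndex m n} (h : a ≠ b) :
    rootMat 0 a b * rootMat 0 a b = 0 := by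
  by_cases hp : parity a = 0 + parity b
  · rw [rootMat_of hp]
    by_cases h2 : a = dual b
    · subst h2
      simp [single_one_mul_single_one, h.symm, Matrix.sub_mul, Matrix.mul_sub, -smul_single]
    · have h3 : dual a ≠ b := fun h3 => h2 (by rw [← h3, dual_dual])
      have h4 := dual_ne a
      have h5 := dual_ne b
      simp [Matrix.sub_mul, Matrix.mul_sub, single_one_mul_single_one, h, h.symm, h4, h5, h4.symm,
        h5.symm]
  · rw [rootMat, if_neg hp, Matrix.zero_mul]

theorem superComm_root_chain {a b c : BasisIndex m n} (hab : parity a = parity b)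
    (hbc : parity b = parity c) (h3 : a ≠ c) (h4 : b ≠ dual a)
    (h5 : b ≠ dual c) : superComm 0 0 (rootMat 0 a b) (rootMat 0 b c) = rootMat 0 a c := by
  have h6 : dual b ≠ a := fun h => h4 (by rw [← h, dual_dual])
  have h7 : dual b ≠ c := fun h => h5 (by rw [← h, dual_dual])
  have h8 : rootSign 0 b c * rootSign 0 a b = rootSign 0 a c := by
    simp [rootSign]
    linear_combination gsign a * gsign c * gsign_mul_self b
  rw [rootMat_of (by simpa using hab), rootMat_of (by simpa using hbc),
    rootMat_of (by simp [hab, hbc]), superComm]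
  simp [Matrix.sub_mul, Matrix.mul_sub, single_one_mul_single_one, h3,
    h3.symm, h4, h4.symm, h5, h5.symm, h6, h6.symm, h7, h7.symm, smul_smul, h8, mul_comm]

theorem superComm_root_chain_long {b c : BasisIndex m n} (hb : parity b = 1)
    (hbc : parity b = parity c) (h5 : b ≠ dual c) :
    superComm 0 0 (rootMat 0 (dual b) b) (rootMat 0 b c) = (2 : ℂ) • rootMat 0 (dual b) c := by
  have h7 : dual b ≠ c := fun h => h5 (by rw [← h, dual_dual])
  have h := rootMat_dual_right (a := dual b) (by simpa using hb)
  rw [dual_dual] at h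
  have h8 : rootSign 0 (dual b) c = -rootSign 0 b c := by
    rw [rootSign, gsign_dual, hb]
    simp [rootSign]
  rw [h, rootMat_of (by simpa using hbc), rootMat_of (by simpa using hbc), superComm, h8]
  simp [Matrix.sub_mul, Matrix.mul_sub, single_one_mul_single_one, h5, h5.symm, h7,
    h7.symm, dual_ne, (dual_ne _).symm, smul_smul, smul_add, mul_comm]

theorem superComm_root_same_left {a b c : BasisIndex m n} (hab : parity a = parity b)
    (hbc : parity b = parity c) (h1 : a ≠ b) (h3 : a ≠ c)
    (h5 : b ≠ dual c) : superComm 0 0 (rootMat 0 a b) (rootMat 0 a c) = 0 := by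
  have h7 : dual b ≠ c := fun h => h5 (by rw [← h, dual_dual])
  rw [rootMat_of (by simpa using hab), rootMat_of (by simp [hab, hbc]), superComm]
  simp [Matrix.sub_mul, Matrix.mul_sub, single_one_mul_single_one, h1, h1.symm, h3,
    h3.symm, h5, h5.symm, h7, h7.symm, dual_ne, (dual_ne _).symm]

/-! ### Heights attached to a ranking of the labels -/

/-- The linear functional on the root lattice attached to `ρ`, evaluated at the weights of the
basis vectors. -/
def rk (ρ : Label m n → ℤ) (a : BasisIndex m n) : ℤ := if a.2 = true then ρ a.1 else -ρ a.1

@[simp] theorem rk_dual (ρ : Label m n → ℤ) (a : BasisIndex m n) : rk ρ (dual a) = -rk ρ a := by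
  obtain ⟨a, b⟩ := a
  cases b <;> simp [rk, dual]

/-- The Cartan element defining the functional `rk ρ`. -/
def heightElt (ρ : Label m n → ℤ) : osp m n 0 := ∑ r, (-(ρ r : ℂ)) • cartan r

/-- The value of a weight at `heightElt ρ`. -/
def height (ρ : Label m n → ℤ) (μ : Weight m n) : ℂ := ∑ r, -(ρ r : ℂ) * μ r

theorem height_wt (ρ : Label m n → ℤ) (a : BasisIndex m n) : height ρ (wt a) = rk ρ a := by
  obtain ⟨a, b⟩ := a
  cases b <;> simp [height, wt, rk, eps, Pi.single_apply, Finset.sum_ite_eq]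

theorem height_add (ρ : Label m n → ℤ) (μ ν : Weight m n) :
    height ρ (μ + ν) = height ρ μ + height ρ ν := by
  simp only [height, Pi.add_apply, mul_add, Finset.sum_add_distrib]

theorem height_sub (ρ : Label m n → ℤ) (μ ν : Weight m n) :
    height ρ (μ - ν) = height ρ μ - height ρ ν := by
  simp only [height, Pi.sub_apply, mul_sub, Finset.sum_sub_distrib]

theorem height_smul (ρ : Label m n → ℤ) (c : ℂ) (μ : Weight m n) :
    height ρ (c • μ) = c * height ρ μ := by
  simp only [height, Finset.mul_sum, Pi.smul_apply, smul_eq_mul]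
  exact Finset.sum_congr rfl fun _ _ => by ring

theorem superComm_smul_left (p q : ZMod 2) (c : ℂ) (A B : Mat m n) :
    superComm p q (c • A) B = c • superComm p q A B := by
  simp [superComm, smul_sub, smul_comm c]

theorem superComm_smul_right (p q : ZMod 2) (c : ℂ) (A B : Mat m n) :
    superComm p q A (c • B) = c • superComm p q A B := by
  simp [superComm, smul_sub, smul_comm c]

theorem superComm_sum_left {ι : Type*} (s : Finset ι) (p q : ZMod 2) (A : ι → Mat m n)
    (B : Mat m n) : superComm p q (∑ i ∈ s, A i) B = ∑ i ∈ s, superComm p q (A i) B := by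
  simp [superComm, Finset.sum_mul, Finset.mul_sum, Finset.smul_sum, Finset.sum_sub_distrib]

theorem superComm_heightElt (ρ : Label m n → ℤ) (p : ZMod 2) (a b : BasisIndex m n) :
    superComm 0 p (heightElt ρ) (rootMat p a b) = ((rk ρ a : ℂ) - rk ρ b) • rootMat p a b := by
  rw [← height_wt, ← height_wt, ← height_sub, height, heightElt, Submodule.coe_sum,
    superComm_sum_left, Finset.sum_smul]
  refine Finset.sum_congr rfl fun r _ => ?_
  rw [Submodule.coe_smul, superComm_smul_left, mul_smul]
  congr 1
  exact superComm_cartanMat_rootMat p r a b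

namespace SuperModule

variable {V : Type*} [AddCommGroup V] [Module ℂ V] (M : SuperModule m n V)

theorem act_act {p q r : ZMod 2} (x : osp m n p) (y : osp m n q) (z : osp m n r) (hr : r = p + q)
    (hz : superComm p q (x : Mat m n) y = z) (u : V) :
    M.act p x (M.act q y u) = M.act r z u + superSign p q • M.act q y (M.act p x u) := by
  subst hr
  obtain rfl : bracket x y = z := Subtype.ext hz
  simp [M.act_bracket]

theorem act_eq_sum_root {p : ZMod 2} (A : osp m n p) (u : V) :
    M.act p A u = (2⁻¹ : ℂ) • ∑ a, ∑ b, (A : Mat m n) a b • M.act p (root p a b) u := by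
  conv_lhs => rw [eq_sum_root A]
  simp [map_sum]

/-- `u` is homogeneous. -/
def Homog (u : V) : Prop := ∃ q, u ∈ M.grade q

theorem Homog.act {u : V} (hu : M.Homog u) (p : ZMod 2) (x : osp m n p) :
    M.Homog (M.act p x u) := by
  obtain ⟨q, hq⟩ := hu
  exact ⟨p + q, M.act_mem p q x u hq⟩

/-- `u` has weight `μ`. -/
def HasWt (μ : Weight m n) (u : V) : Prop := ∀ r, M.act 0 (cartan r) u = μ r • u

variable {M}

theorem HasWt.act_root {μ : Weight m n} {u : V} (hu : M.HasWt μ u) (p : ZMod 2)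
    (a b : BasisIndex m n) : M.HasWt (μ + (wt a - wt b)) (M.act p (root p a b) u) := by
  intro r
  rw [M.act_act (cartan r) (root p a b) ((wt a r - wt b r) • root p a b) (zero_add p).symm
    (superComm_cartanMat_rootMat p r a b), hu r]
  simp [add_smul, add_comm]

theorem HasWt.act_coroot {μ : Weight m n} {u : V} (hu : M.HasWt μ u) (a : BasisIndex m n) :
    M.act 0 (coroot a) u = (if a.2 = true then -μ a.1 else μ a.1) • u := by
  rw [coroot, map_smul, LinearMap.smul_apply, hu a.1]
  split_ifs <;> simp

theorem HasWt.act_heightElt {μ : Weight m n} {u : V} (hu : M.HasWt μ u) (ρ : Label m n → ℤ) :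
    M.act 0 (heightElt ρ) u = height ρ μ • u := by
  simp only [heightElt, height, map_sum, map_smul, LinearMap.sum_apply, LinearMap.smul_apply,
    hu _, Finset.sum_smul, smul_smul]

/-- A span of homogeneous vectors is automatically graded, and stability under root vectors is
stability under everything, so irreducibility applies. -/
theorem IsIrreducible.span_eq_top (hM : M.IsIrreducible) {S : Set V} (hS : ∀ s ∈ S, M.Homog s)
    (hne : ∃ s ∈ S, s ≠ 0)
    (hact : ∀ s ∈ S, ∀ p a b, M.act p (root p a b) s ∈ Submodule.span ℂ S) :
    Submodule.span ℂ S = ⊤ := by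
  refine (hM.2 _ ?_ ?_).resolve_left ?_
  · rw [Submodule.span_le]
    intro s hs
    obtain ⟨q, hq⟩ := hS s hs
    exact (le_iSup (fun p => Submodule.span ℂ S ⊓ M.grade p) q) ⟨Submodule.subset_span hs, hq⟩
  · intro p x v hv
    have : Submodule.span ℂ S ≤ (Submodule.span ℂ S).comap (M.act p x) := by
      rw [Submodule.span_le]
      intro s hs
      show M.act p x s ∈ Submodule.span ℂ S
      rw [M.act_eq_sum_root]
      exact Submodule.smul_mem _ _ (Submodule.sum_mem _ fun a _ => Submodule.sum_mem _ fun b _ =>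
        Submodule.smul_mem _ _ (hact s hs p a b))
    exact this hv
  · obtain ⟨s, hs, h0⟩ := hne
    intro h
    have := Submodule.subset_span (R := ℂ) hs
    rw [h] at this
    exact h0 this

end SuperModule

/-! ### Singular vectors and their heights -/

/-- All nonzero entries of `A` raise the rank, i.e. `A` lies in the nilradical of the Borel
subalgebra attached to `ρ`. -/
def IsUpper (ρ : Label m n → ℤ) (A : Mat m n) : Prop := ∀ a b, A a b ≠ 0 → rk ρ b < rk ρ a

theorem isUpper_rootMat {ρ : Label m n → ℤ} {p : ZMod 2} {a b : BasisIndex m n}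
    (h : rk ρ b < rk ρ a) : IsUpper ρ (rootMat p a b) := by
  intro k l hkl
  by_cases hp : parity a = p + parity b
  · rw [rootMat_of hp] at hkl
    by_cases h1 : a = k ∧ b = l
    · obtain ⟨rfl, rfl⟩ := h1
      exact h
    · by_cases h2 : dual b = k ∧ dual a = l
      · obtain ⟨rfl, rfl⟩ := h2
        simpa using h
      · simp [single_apply, h1, h2] at hkl
  · simp [rootMat, hp] at hkl

namespace SuperModule

variable {V : Type*} [AddCommGroup V] [Module ℂ V] (M : SuperModule m n V)

/-- A homogeneous highest weight vector of weight `μ` for the Borel subalgebra attached to `ρ`. -/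
structure IsSingular (ρ : Label m n → ℤ) (μ : Weight m n) (u : V) : Prop where
  ne_zero : u ≠ 0
  homog : M.Homog u
  hasWt : M.HasWt μ u
  act_eq_zero : ∀ (p : ZMod 2) (A : osp m n p), IsUpper ρ (A : Mat m n) → M.act p A u = 0

/-- The vectors obtained from `u` by applying lowering operators. -/
inductive Descendant (ρ : Label m n → ℤ) (u : V) : V → Prop
  | base : Descendant ρ u u
  | step (w : V) (p : ZMod 2) (a b : BasisIndex m n) (h : rk ρ a ≤ rk ρ b)
      (hw : Descendant ρ u w) : Descendant ρ u (M.act p (root p a b) w)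

variable {M}

/-- A raising operator is moved past the outermost lowering operator. Both resulting terms apply
some element of the algebra to a shorter descendant, which the induction hypothesis covers. -/
theorem IsSingular.act_descendant {ρ : Label m n → ℤ} {μ : Weight m n} {u : V}
    (hu : M.IsSingular ρ μ u) {w : V} (hw : M.Descendant ρ u w) (p : ZMod 2) (x : osp m n p) :
    M.act p x w ∈ Submodule.span ℂ {w | M.Descendant ρ u w} := by
  suffices H : ∀ p a b, M.act p (root p a b) w ∈ Submodule.span ℂ {w | M.Descendant ρ u w} by
    rw [M.act_eq_sum_root]
    exact Submodule.smul_mem _ _ (Submodule.sum_mem _ fun a _ => Submodule.sum_mem _ fun b _ =>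
        Submodule.smul_mem _ _ (H p a b))
  clear x p
  induction hw with
  | base =>
    intro p a b
    rcases le_or_gt (rk ρ a) (rk ρ b) with h | h
    · exact Submodule.subset_span (Descendant.step _ _ _ _ h .base)
    · rw [hu.act_eq_zero p (root p a b) (isUpper_rootMat h)]
      exact Submodule.zero_mem _
  | step w q c d hcd hw ih =>
    intro p a b
    rcases le_or_gt (rk ρ a) (rk ρ b) with h | h
    · exact Submodule.subset_span (Descendant.step _ _ _ _ h (Descendant.step _ _ _ _ hcd hw))
    · rw [M.act_act (root p a b) (root q c d) (bracket (root p a b) (root q c d)) rfl rfl]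
      have ih' : ∀ (p : ZMod 2) (x : osp m n p),
          M.act p x w ∈ Submodule.span ℂ {w | M.Descendant ρ u w} := by
        intro p x
        rw [M.act_eq_sum_root]
        exact Submodule.smul_mem _ _ (Submodule.sum_mem _ fun a _ => Submodule.sum_mem _ fun b _ =>
          Submodule.smul_mem _ _ (ih p a b))
      refine Submodule.add_mem _ (ih' _ _) (Submodule.smul_mem _ _ ?_)
      have : Submodule.span ℂ {w | M.Descendant ρ u w} ≤
          (Submodule.span ℂ {w | M.Descendant ρ u w}).comap (M.act q (root q c d)) := by
        rw [Submodule.span_le]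
        intro s hs
        exact Submodule.subset_span (Descendant.step _ _ _ _ hcd hs)
      exact this (ih' _ _)

theorem IsSingular.homog_of_descendant {ρ : Label m n → ℤ} {μ : Weight m n} {u : V}
    (hu : M.IsSingular ρ μ u) {w : V} (hw : M.Descendant ρ u w) : M.Homog w := by
  induction hw with
  | base => exact hu.homog
  | step w q c d hcd hw ih => exact ih.act M q _

theorem IsSingular.height_of_descendant {ρ : Label m n → ℤ} {μ : Weight m n} {u : V}
    (hu : M.IsSingular ρ μ u) {w : V} (hw : M.Descendant ρ u w) :
    ∃ k : ℕ, M.act 0 (heightElt ρ) w = (height ρ μ - k) • w := by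
  induction hw with
  | base => exact ⟨0, by simpa using hu.hasWt.act_heightElt ρ⟩
  | step w p c d hcd hw ih =>
    obtain ⟨k, hk⟩ := ih
    obtain ⟨l, hl⟩ := Int.le.dest hcd
    refine ⟨k + l, ?_⟩
    rw [M.act_act (heightElt ρ) (root p c d) (((rk ρ c : ℂ) - rk ρ d) • root p c d)
      (zero_add p).symm (superComm_heightElt ρ p c d), hk, ← hl]
    push_cast
    simp only [map_smul, LinearMap.smul_apply, superSign_zero_left, one_smul]
    rw [← add_smul]
    congr 1
    ring

theorem IsSingular.span_descendant (hM : M.IsIrreducible) {ρ : Label m n → ℤ} {μ : Weight m n}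
    {u : V} (hu : M.IsSingular ρ μ u) : Submodule.span ℂ {w | M.Descendant ρ u w} = ⊤ :=
  hM.span_eq_top (fun _ hs => hu.homog_of_descendant hs) ⟨u, .base, hu.ne_zero⟩
    fun _ hs p _ _ => hu.act_descendant hs p _

/-- The descendants span V and are eigenvectors of the height operator with eigenvalues height μ -
k. Eigenspaces being independent, no other eigenvalue can have a nonzero eigenvector. -/
theorem IsSingular.exists_height_eq (hM : M.IsIrreducible) {ρ : Label m n → ℤ}
    {μ ν : Weight m n} {u w : V} (hu : M.IsSingular ρ μ u) (hw : w ≠ 0) (hwt : M.HasWt ν w) :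
    ∃ k : ℕ, height ρ ν = height ρ μ - k := by
  by_contra! H
  set T := M.act 0 (heightElt ρ)
  have h1 : (⊤ : Submodule ℂ V) ≤ ⨆ (c : ℂ) (_ : c ≠ height ρ ν), Module.End.eigenspace T c := by
    rw [← hu.span_descendant hM, Submodule.span_le]
    intro s hs
    obtain ⟨k, hk⟩ := hu.height_of_descendant hs
    exact (le_iSup₂ (f := fun (c : ℂ) (_ : c ≠ height ρ ν) => Module.End.eigenspace T c)
      (height ρ μ - k) (H k).symm) (Module.End.mem_eigenspace_iff.2 hk)
  have h2 := (Module.End.eigenspaces_iSupIndep T) (height ρ ν)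
  exact hw ((Submodule.disjoint_def.1 h2) w (Module.End.mem_eigenspace_iff.2 (hwt.act_heightElt ρ))
    (h1 trivial))

/-- Each singular vector generates V, so each height is at most the other in the sense of
`exists_height_eq`. This is the form in which irreducibility forbids new singular vectors. -/
theorem IsSingular.height_eq (hM : M.IsIrreducible) {ρ : Label m n → ℤ} {μ ν : Weight m n}
    {u w : V} (hu : M.IsSingular ρ μ u) (hw : M.IsSingular ρ ν w) :
    height ρ μ = height ρ ν := by
  obtain ⟨k, hk⟩ := hu.exists_height_eq hM hw.ne_zero hw.hasWt
  obtain ⟨l, hl⟩ := hw.exists_height_eq hM hu.ne_zero hu.hasWt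
  have : ((k + l : ℕ) : ℂ) = 0 := by
    push_cast
    linear_combination hk + hl
  have h0 : k + l = 0 := by exact_mod_cast this
  obtain rfl : k = 0 := by omega
  simpa using hk.symm

end SuperModule

/-! ### Simple roots as adjacent ranks -/

theorem rootMat_support {p : ZMod 2} {a b k l : BasisIndex m n} (h : rootMat p a b k l ≠ 0) :
    (k = a ∧ l = b) ∨ (k = dual b ∧ l = dual a) := by
  by_cases hp : parity a = p + parity b
  · rw [rootMat_of hp] at h
    by_cases h1 : a = k ∧ b = l
    · exact Or.inl ⟨h1.1.symm, h1.2.symm⟩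
    · by_cases h2 : dual b = k ∧ dual a = l
      · exact Or.inr ⟨h2.1.symm, h2.2.symm⟩
      · simp [single_apply, h1, h2] at h
  · simp [rootMat, hp] at h

/-- Nothing lies strictly between the ranks of `j` and `i`, so that the roots of `i` and `j`
differ by a simple root. -/
def IsAdjacent (ρ : Label m n → ℤ) (i j : BasisIndex m n) : Prop :=
  rk ρ j < rk ρ i ∧ ∀ k, rk ρ j < rk ρ k → rk ρ i ≤ rk ρ k

theorem entry_dual_eq_zero {q : ZMod 2} (A : osp m n q) {i j : BasisIndex m n}
    (h : (A : Mat m n) i j = 0) : (A : Mat m n) (dual j) (dual i) = 0 := by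
  rw [(mem_osp_iff_entries.1 A.2).2, h]
  simp

theorem mul_apply_ne_zero {A B : Mat m n} {a b : BasisIndex m n} (h : (A * B) a b ≠ 0) :
    ∃ c, A a c ≠ 0 ∧ B c b ≠ 0 := by
  by_contra! H
  refine h ?_
  rw [Matrix.mul_apply]
  refine Finset.sum_eq_zero fun c _ => ?_
  by_cases h1 : A a c = 0
  · rw [h1, zero_mul]
  · rw [H c h1, mul_zero]

theorem superComm_apply_ne_zero {p q : ZMod 2} {A B : Mat m n} {a b : BasisIndex m n}
    (h : superComm p q A B a b ≠ 0) :
    (∃ c, A a c ≠ 0 ∧ B c b ≠ 0) ∨ ∃ c, B a c ≠ 0 ∧ A c b ≠ 0 := by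
  by_cases h1 : (A * B) a b = 0
  · refine Or.inr (mul_apply_ne_zero fun h2 => h ?_)
    simp [superComm, h1, h2]
  · exact Or.inl (mul_apply_ne_zero h1)

/-- Subtracting a simple root from a different positive root never leaves the positive roots. In
terms of ranks: with nothing between j and i, a strict inequality against one of them that avoids
the other remains strict after exchanging them. -/
theorem IsAdjacent.superComm {ρ : Label m n → ℤ} (hρ : Function.Injective (rk ρ))
    {i j : BasisIndex m n} (hij : IsAdjacent ρ i j) {q : ZMod 2} (p : ZMod 2) (A : osp m n q)
    (hA : IsUpper ρ (A : Mat m n)) (h0 : (A : Mat m n) i j = 0) :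
    IsUpper ρ (superComm q p (A : Mat m n) (rootMat p j i)) ∧
      superComm q p (A : Mat m n) (rootMat p j i) i j = 0 := by
  have h0' := entry_dual_eq_zero A h0
  have hne : i ≠ j := by
    rintro rfl
    exact lt_irrefl _ hij.1
  have up : ∀ k, rk ρ j < rk ρ k → k ≠ i → rk ρ i < rk ρ k := fun k hk hki =>
    lt_of_le_of_ne (hij.2 k hk) fun h => hki (hρ h.symm)
  have down : ∀ k, rk ρ k < rk ρ i → k ≠ j → rk ρ k < rk ρ j := by
    intro k hk hkj
    refine lt_of_le_of_ne (not_lt.1 fun h => ?_) fun h => hkj (hρ h)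
    exact absurd (hij.2 k h) (not_le.2 hk)
  constructor
  · intro a b hab
    rcases superComm_apply_ne_zero hab with ⟨c, hc, hf⟩ | ⟨c, hf, hc⟩
    · rcases rootMat_support hf with ⟨rfl, rfl⟩ | ⟨rfl, rfl⟩
      · refine up a (hA _ _ hc) ?_
        rintro rfl
        exact hc h0
      · have := hA _ _ hc
        have h1 := down (dual a) (by simpa [neg_lt] using this) (by
          rintro rfl
          exact hc (by simpa using h0'))
        simpa [neg_lt] using h1
    · rcases rootMat_support hf with ⟨rfl, rfl⟩ | ⟨rfl, rfl⟩
      · refine down b (hA _ _ hc) ?_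
        rintro rfl
        exact hc h0
      · have := hA _ _ hc
        have h1 := up (dual b) (by simpa [lt_neg] using this) (by
          rintro rfl
          exact hc (by simpa using h0'))
        simpa [lt_neg] using h1
  · by_contra hab
    rcases superComm_apply_ne_zero hab with ⟨c, hc, hf⟩ | ⟨c, hf, hc⟩
    · rcases rootMat_support hf with ⟨h1, h2⟩ | ⟨h1, h2⟩
      · exact hne h2.symm
      · exact dual_ne j h2.symm
    · rcases rootMat_support hf with ⟨h1, h2⟩ | ⟨h1, h2⟩
      · exact hne h1
      · exact dual_ne i h1.symm

/-! ### sl₂ triples of even roots -/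

/-- The value of a weight at `coroot a`. -/
def pairing (a : BasisIndex m n) (μ : Weight m n) : ℂ := if a.2 = true then -μ a.1 else μ a.1

theorem pairing_sub (a : BasisIndex m n) (μ ν : Weight m n) :
    pairing a (μ - ν) = pairing a μ - pairing a ν := by
  simp only [pairing, Pi.sub_apply]
  split_ifs <;> ring

@[simp] theorem pairing_wt_self (a : BasisIndex m n) : pairing a (wt a) = 1 := by
  obtain ⟨a, b⟩ := a
  cases b <;> simp [pairing, wt, eps]

theorem pairing_wt_of_ne {a b : BasisIndex m n} (h : a.1 ≠ b.1) : pairing a (wt b) = 0 := by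
  obtain ⟨a, c⟩ := a
  obtain ⟨b, d⟩ := b
  cases c <;> cases d <;> simp_all [pairing, wt, eps]

theorem superComm_coroot (p : ZMod 2) (r a b : BasisIndex m n) :
    superComm 0 p (coroot r) (rootMat p a b) = pairing r (wt a - wt b) • rootMat p a b := by
  rw [coroot, Submodule.coe_smul, superComm_smul_left]
  have := superComm_cartanMat_rootMat p r.1 a b
  rw [show ((cartan r.1 : osp m n 0) : Mat m n) = cartanMat r.1 from rfl, this, smul_smul, pairing]
  congr 1
  split_ifs <;> simp

/-- `a` and `b` are labels of equal parity whose weights differ by a root. -/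
def IsEvenPair (a b : BasisIndex m n) : Prop :=
  parity a = parity b ∧ (a.1 ≠ b.1 ∨ (b = dual a ∧ parity a = 1))

/-- The coroot of the root `wt a - wt b`. -/
noncomputable def pairCoroot (a b : BasisIndex m n) : osp m n 0 :=
  if a.1 = b.1 then coroot a else coroot a - coroot b

/-- The value of a weight at the coroot of `wt a - wt b`. -/
noncomputable def pairVal (a b : BasisIndex m n) (μ : Weight m n) : ℂ :=
  if a.1 = b.1 then pairing a μ else pairing a μ - pairing b μ

/-- The root vector of the root `wt a - wt b`, scaled so as to form `sl₂` triples. -/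
noncomputable def pairElt (a b : BasisIndex m n) : osp m n 0 :=
  (if a.1 = b.1 then (2⁻¹ : ℂ) else 1) • root 0 a b

theorem IsEvenPair.superComm_pairElt {a b : BasisIndex m n} (h : IsEvenPair a b) :
    superComm 0 0 (pairElt a b) (pairElt b a : Mat m n) = pairCoroot a b := by
  rw [pairElt, pairElt, Submodule.coe_smul, Submodule.coe_smul, superComm_smul_left,
    superComm_smul_right, pairCoroot]
  obtain ⟨hp, h1 | ⟨rfl, h1⟩⟩ := h
  · have := superComm_root_opposite (p := 0) (by simpa using hp) h1
    simp only [if_neg h1, if_neg (Ne.symm h1), one_smul, superSign_zero_left] at this ⊢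
    exact this
  · have := superComm_root_long h1
    simp only [dual_fst, if_true]
    refine (congrArg _ (congrArg _ this)).trans ?_
    simp [smul_smul]
    norm_num

theorem IsEvenPair.superComm_pairCoroot {a b : BasisIndex m n} (h : IsEvenPair a b) :
    superComm 0 0 (pairCoroot a b) (pairElt b a : Mat m n) = (-2 : ℂ) • (pairElt b a : Mat m n) := by
  rw [pairElt, Submodule.coe_smul, superComm_smul_right, smul_comm]
  congr 1
  obtain ⟨hp, h1 | ⟨rfl, h1⟩⟩ := h
  · rw [pairCoroot, if_neg h1]
    have e : superComm 0 0 ((coroot a - coroot b : osp m n 0) : Mat m n) (root 0 b a) =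
        superComm 0 0 (coroot a) (rootMat 0 b a) - superComm 0 0 (coroot b) (rootMat 0 b a) := by
      simp [superComm, Matrix.sub_mul, Matrix.mul_sub, root]
      abel
    rw [e, superComm_coroot, superComm_coroot, ← sub_smul, pairing_sub, pairing_sub,
      pairing_wt_self, pairing_wt_self, pairing_wt_of_ne h1, pairing_wt_of_ne (Ne.symm h1)]
    norm_num [root]
  · rw [pairCoroot, dual_fst, if_pos rfl]
    refine (superComm_coroot 0 a (dual a) a).trans ?_
    have : pairing a (wt (dual a) - wt a) = -2 := by
      have h3 : wt (dual a) - wt a = (0 - wt a) - wt a := by simp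
      rw [h3, pairing_sub, pairing_sub, pairing_wt_self]
      simp [pairing]
      norm_num
    rw [this]
    rfl

section Sl2

variable {V : Type*} [AddCommGroup V] [Module ℂ V] {E F H : Module.End ℂ V}

theorem sl2_coroot_pow (hHF : ∀ x, H (F x) = F (H x) - (2 : ℂ) • F x) {u : V} {c : ℂ}
    (hu : H u = c • u) (k : ℕ) : H ((F ^ k) u) = (c - 2 * k) • (F ^ k) u := by
  induction k with
  | zero => simpa using hu
  | succ k ih =>
    rw [pow_succ', Module.End.mul_apply, hHF, ih, map_smul, ← sub_smul]
    congr 1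
    push_cast
    ring

theorem sl2_raise_pow (hHF : ∀ x, H (F x) = F (H x) - (2 : ℂ) • F x)
    (hEF : ∀ x, E (F x) = H x + F (E x)) {u : V} {c : ℂ} (hu : H u = c • u) (he : E u = 0)
    (k : ℕ) : E ((F ^ (k + 1)) u) = ((k + 1) * (c - k)) • (F ^ k) u := by
  induction k with
  | zero => simp [hEF, hu, he]
  | succ k ih =>
    rw [pow_succ', Module.End.mul_apply, hEF, ih, map_smul, sl2_coroot_pow hHF hu,
      ← Module.End.mul_apply, ← pow_succ', ← add_smul]
    congr 1
    push_cast
    ring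

/-- The vectors F^k u have distinct H-eigenvalues c - 2k, so some F^{N+1} u is the first to vanish;
applying E gives (N+1)(c - N) = 0. -/
theorem sl2_exists_nat [FiniteDimensional ℂ V] (hHF : ∀ x, H (F x) = F (H x) - (2 : ℂ) • F x)
    (hEF : ∀ x, E (F x) = H x + F (E x)) {u : V} {c : ℂ} (h0 : u ≠ 0) (hu : H u = c • u)
    (he : E u = 0) : ∃ N : ℕ, c = N := by
  have hex : ∃ k, (F ^ k) u = 0 := by
    by_contra! hne
    refine Set.infinite_of_injective_forall_mem (f := fun k : ℕ => c - 2 * (k : ℂ)) ?_ ?_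
      (Module.End.finite_hasEigenvalue H)
    · intro k l hkl
      simpa using hkl
    · intro k
      exact Module.End.hasEigenvalue_of_hasEigenvector
        ⟨Module.End.mem_eigenspace_iff.2 (sl2_coroot_pow hHF hu k), hne k⟩
  obtain ⟨N, hN, hN'⟩ := Nat.exists_not_and_succ_of_not_zero_of_exists
    (p := fun k => (F ^ k) u = 0) (by simpa using h0) hex
  refine ⟨N, ?_⟩
  have h := sl2_raise_pow hHF hEF hu he N
  rw [hN', map_zero, eq_comm, smul_eq_zero_iff_left hN, mul_eq_zero, sub_eq_zero] at h
  exact h.resolve_left (Nat.cast_add_one_ne_zero N)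

end Sl2

namespace SuperModule

variable {V : Type*} [AddCommGroup V] [Module ℂ V] {M : SuperModule m n V}

theorem act_pairElt_pairElt {a b : BasisIndex m n} (h : IsEvenPair a b) (x : V) :
    M.act 0 (pairElt a b) (M.act 0 (pairElt b a) x) =
      M.act 0 (pairCoroot a b) x + M.act 0 (pairElt b a) (M.act 0 (pairElt a b) x) := by
  rw [M.act_act (pairElt a b) (pairElt b a) (pairCoroot a b) (zero_add 0).symm
    h.superComm_pairElt]
  simp

theorem act_pairCoroot_pairElt {a b : BasisIndex m n} (h : IsEvenPair a b) (x : V) :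
    M.act 0 (pairCoroot a b) (M.act 0 (pairElt b a) x) =
      M.act 0 (pairElt b a) (M.act 0 (pairCoroot a b) x) - (2 : ℂ) • M.act 0 (pairElt b a) x := by
  rw [M.act_act (pairCoroot a b) (pairElt b a) ((-2 : ℂ) • pairElt b a) (zero_add 0).symm
    h.superComm_pairCoroot, map_smul]
  simp
  abel

theorem HasWt.act_pairCoroot {μ : Weight m n} {u : V} (hu : M.HasWt μ u) (a b : BasisIndex m n) :
    M.act 0 (pairCoroot a b) u = pairVal a b μ • u := by
  rw [pairCoroot, pairVal]
  split_ifs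
  · exact hu.act_coroot a
  · rw [map_sub, LinearMap.sub_apply, hu.act_coroot, hu.act_coroot, sub_smul]
    rfl

theorem isUpper_pairElt {ρ : Label m n → ℤ} {a b : BasisIndex m n} (h : rk ρ b < rk ρ a) :
    IsUpper ρ (pairElt a b : Mat m n) := by
  intro k l hkl
  refine isUpper_rootMat (p := 0) h k l (fun h0 => hkl ?_)
  rw [pairElt, Submodule.coe_smul, Matrix.smul_apply]
  exact (congrArg _ h0).trans (smul_zero _)

theorem IsSingular.exists_pairVal_eq_nat [FiniteDimensional ℂ V] {ρ : Label m n → ℤ}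
    {μ : Weight m n} {u : V} (hu : M.IsSingular ρ μ u) {a b : BasisIndex m n}
    (h : IsEvenPair a b) (hab : rk ρ b < rk ρ a) : ∃ N : ℕ, pairVal a b μ = N :=
  sl2_exists_nat (act_pairCoroot_pairElt h) (act_pairElt_pairElt h) hu.ne_zero
    (hu.hasWt.act_pairCoroot a b) (hu.act_eq_zero 0 _ (isUpper_pairElt hab))

/-- `w` is killed by the nilradical of the parabolic subalgebra of the simple root of `i, j`. -/
def KilledBelow (M : SuperModule m n V) (ρ : Label m n → ℤ) (i j : BasisIndex m n) (w : V) :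
    Prop :=
  ∀ (q : ZMod 2) (A : osp m n q), IsUpper ρ (A : Mat m n) → (A : Mat m n) i j = 0 →
    M.act q A w = 0

theorem IsSingular.killedBelow {ρ : Label m n → ℤ} {μ : Weight m n} {u : V}
    (hu : M.IsSingular ρ μ u) (i j : BasisIndex m n) : M.KilledBelow ρ i j u :=
  fun q A hA _ => hu.act_eq_zero q A hA

theorem KilledBelow.act_root {ρ : Label m n → ℤ} (hρ : Function.Injective (rk ρ))
    {i j : BasisIndex m n} (hij : IsAdjacent ρ i j) {w : V} (hw : M.KilledBelow ρ i j w)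
    (p : ZMod 2) : M.KilledBelow ρ i j (M.act p (root p j i) w) := by
  intro q A hA h0
  obtain ⟨h1, h2⟩ := hij.superComm hρ p A hA h0
  rw [M.act_act A (root p j i) (bracket A (root p j i)) rfl rfl, hw q A hA h0,
    hw _ (bracket A (root p j i)) h1 h2]
  simp

theorem rootMat_entry_ne_zero {p : ZMod 2} {i j : BasisIndex m n} (hp : parity i = p + parity j)
    (h : i.1 ≠ j.1 ∨ (j = dual i ∧ parity i = 1)) : rootMat p i j i j ≠ 0 := by
  rcases h with h | ⟨rfl, h⟩
  · have h1 : ¬ (dual j = i ∧ dual i = j) := fun h2 => h (h2.1 ▸ rfl)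
    rw [rootMat_of hp]
    simp [single_apply, h1]
  · obtain rfl : p = 0 := by simpa using hp
    rw [rootMat_dual_right h]
    simp

/-- Modulo a multiple of the simple root vector, every upper matrix has zero entry at (i, j), so it
remains only to kill u by that one vector. -/
theorem KilledBelow.act_eq_zero {ρ : Label m n → ℤ} {p : ZMod 2}
    {i j : BasisIndex m n} (hp : parity i = p + parity j)
    (hr : i.1 ≠ j.1 ∨ (j = dual i ∧ parity i = 1)) (hij : rk ρ j < rk ρ i) {w : V}
    (hw : M.KilledBelow ρ i j w)
    (h0 : M.act p (root p i j) w = 0) (q : ZMod 2) (A : osp m n q)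
    (hA : IsUpper ρ (A : Mat m n)) : M.act q A w = 0 := by
  by_cases hz : (A : Mat m n) i j = 0
  · exact hw q A hA hz
  · have hq : parity i = q + parity j := by
      by_contra h
      exact hz (A.2.1 i j h)
    obtain rfl : p = q := by
      rw [hp] at hq
      exact add_right_cancel hq
    have hs := rootMat_entry_ne_zero hp hr
    set s := rootMat p i j i j
    set B : osp m n p := A - ((A : Mat m n) i j / s) • root p i j
    have hB : M.act p B w = 0 := by
      refine hw p B ?_ ?_
      · intro k l hkl
        by_cases h1 : (A : Mat m n) k l = 0
        · refine isUpper_rootMat hij k l (p := p) fun h2 => hkl ?_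
          simp [B, root, h1, h2]
        · exact hA k l h1
      · simp only [B, root, Submodule.coe_sub, Submodule.coe_smul, Matrix.sub_apply,
          Matrix.smul_apply, smul_eq_mul]
        rw [div_mul_cancel₀ _ hs, sub_self]
    have hAB : A = B + ((A : Mat m n) i j / s) • root p i j := by simp [B]
    rw [hAB, map_add, LinearMap.add_apply, hB, map_smul, LinearMap.smul_apply, h0]
    simp

theorem HasWt.act_root_pow {μ : Weight m n} {u : V} (hu : M.HasWt μ u) (p : ZMod 2)
    (a b : BasisIndex m n) (k : ℕ) :
    M.HasWt (μ + (k : ℂ) • (wt a - wt b)) ((M.act p (root p a b) ^ k) u) := by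
  induction k with
  | zero => simpa using hu
  | succ k ih =>
    rw [pow_succ', Module.End.mul_apply]
    convert ih.act_root p a b using 1
    push_cast
    rw [add_smul, one_smul, add_assoc]

theorem Homog.act_pow {u : V} (hu : M.Homog u) (p : ZMod 2) (x : osp m n p) (k : ℕ) :
    M.Homog ((M.act p x ^ k) u) := by
  induction k with
  | zero => simpa using hu
  | succ k ih =>
    rw [pow_succ', Module.End.mul_apply]
    exact ih.act M p x

/-- The factor c - N in `sl2_raise_pow` vanishes, so the vector is killed by the simple raising
operator and, by `KilledBelow`, by the rest of the nilradical. Were it nonzero, it would be singular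
of a different height. -/
theorem IsSingular.root_pow_eq_zero (hM : M.IsIrreducible) {ρ : Label m n → ℤ}
    (hρ : Function.Injective (rk ρ)) {μ : Weight m n} {u : V} (hu : M.IsSingular ρ μ u)
    {i j : BasisIndex m n} (h : IsEvenPair i j) (hij : IsAdjacent ρ i j) {N : ℕ}
    (hN : pairVal i j μ = N) : (M.act 0 (root 0 j i) ^ (N + 1)) u = 0 := by
  by_contra hne
  set w := (M.act 0 (root 0 j i) ^ (N + 1)) u
  have hk : ∀ k, M.KilledBelow ρ i j ((M.act 0 (root 0 j i) ^ k) u) := by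
    intro k
    induction k with
    | zero => simpa using hu.killedBelow i j
    | succ k ih =>
      rw [pow_succ', Module.End.mul_apply]
      exact ih.act_root hρ hij 0
  have hc : (if i.1 = j.1 then (2⁻¹ : ℂ) else 1) ≠ 0 := by split_ifs <;> norm_num
  have hc' : (if j.1 = i.1 then (2⁻¹ : ℂ) else 1) ≠ 0 := by split_ifs <;> norm_num
  have he : M.act 0 (root 0 i j) w = 0 := by
    have h1 := sl2_raise_pow (act_pairCoroot_pairElt h) (act_pairElt_pairElt h)
      (hu.hasWt.act_pairCoroot i j) (hu.act_eq_zero 0 _ (isUpper_pairElt hij.1)) N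
    rw [hN, sub_self, mul_zero, zero_smul, pairElt, pairElt, map_smul, map_smul, smul_pow,
      LinearMap.smul_apply, LinearMap.smul_apply, map_smul, smul_eq_zero_iff_right hc,
      smul_eq_zero_iff_right (pow_ne_zero _ hc')] at h1
    exact h1
  have hp : parity i = 0 + parity j := by simpa using h.1
  have hw : M.IsSingular ρ (μ + ((N + 1 : ℕ) : ℂ) • (wt j - wt i)) w :=
    ⟨hne, hu.homog.act_pow 0 _ _, hu.hasWt.act_root_pow 0 j i _,
      (hk (N + 1)).act_eq_zero hp h.2 hij.1 he⟩
  have h1 := hu.height_eq hM hw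
  rw [height_add, height_smul, height_sub, height_wt, height_wt] at h1
  have h2 : ((N + 1 : ℕ) : ℂ) * ((rk ρ j - rk ρ i : ℤ) : ℂ) = 0 := by
    push_cast at h1 ⊢
    linear_combination -h1
  rcases mul_eq_zero.1 h2 with h3 | h3
  · exact Nat.cast_ne_zero.2 (Nat.succ_ne_zero N) h3
  · have h4 : rk ρ j - rk ρ i = 0 := by exact_mod_cast h3
    have := hij.1
    omega

end SuperModule

/-! ### Odd reflections -/

theorem rootMat_mul_self_of_fst_ne (p : ZMod 2) {a b : BasisIndex m n} (h : a.1 ≠ b.1) :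
    rootMat p a b * rootMat p a b = 0 := by
  by_cases hp : parity a = p + parity b
  · rw [rootMat_of hp]
    have h1 : b ≠ a := fun h1 => h (h1 ▸ rfl)
    have h2 : dual a ≠ a := dual_ne a
    have h3 : b ≠ dual b := (dual_ne b).symm
    have h4 : dual a ≠ dual b := fun h1 => h (by simpa using congrArg Prod.fst h1)
    simp [Matrix.sub_mul, Matrix.mul_sub, single_one_mul_single_one, h1, h2, h3, h4, h1.symm]
  · rw [rootMat, if_neg hp, Matrix.zero_mul]

namespace SuperModule

variable {V : Type*} [AddCommGroup V] [Module ℂ V] {M : SuperModule m n V}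

section OddReflection

variable {ρ ρ' : Label m n → ℤ} {μ : Weight m n} {u : V} {i j : BasisIndex m n}

theorem IsSingular.act_odd_ne_zero (hu : M.IsSingular ρ μ u) (hp : parity i = 1 + parity j)
    (hij : rk ρ j < rk ρ i) (hne : i.1 ≠ j.1) (h : pairing i μ + pairing j μ ≠ 0) :
    M.act 1 (root 1 j i) u ≠ 0 := by
  intro h0
  have h1 := M.act_act (root 1 i j) (root 1 j i) (coroot i + coroot j) (r := 0) (by decide)
    ((superComm_root_opposite hp hne).trans (by simp)) u
  rw [h0, map_zero, hu.act_eq_zero 1 _ (isUpper_rootMat hij), map_zero, smul_zero, add_zero,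
    map_add, LinearMap.add_apply, hu.hasWt.act_coroot, hu.hasWt.act_coroot, ← add_smul] at h1
  exact (smul_ne_zero h hu.ne_zero) h1.symm

/-- Here e f u = (h_i + h_j) u = 0, so a nonzero f u would be singular of lower height. -/
theorem IsSingular.act_odd_eq_zero (hM : M.IsIrreducible) (hρ : Function.Injective (rk ρ))
    (hu : M.IsSingular ρ μ u) (hp : parity i = 1 + parity j)
    (hij : IsAdjacent ρ i j) (hne : i.1 ≠ j.1) (h : pairing i μ + pairing j μ = 0) :
    M.act 1 (root 1 j i) u = 0 := by
  by_contra h0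
  have h1 := M.act_act (root 1 i j) (root 1 j i) (coroot i + coroot j) (r := 0) (by decide)
    ((superComm_root_opposite hp hne).trans (by simp)) u
  rw [hu.act_eq_zero 1 (root 1 i j) (isUpper_rootMat hij.1), map_zero, smul_zero, add_zero,
    map_add, LinearMap.add_apply, hu.hasWt.act_coroot, hu.hasWt.act_coroot, ← add_smul] at h1
  have h2 : M.act 1 (root 1 i j) (M.act 1 (root 1 j i) u) = 0 := by
    rw [h1]
    exact (congrArg (· • u) h).trans (zero_smul _ _)
  have hw : M.IsSingular ρ (μ + (wt j - wt i)) (M.act 1 (root 1 j i) u) :=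
    ⟨h0, hu.homog.act M 1 _, hu.hasWt.act_root 1 j i,
      ((hu.killedBelow i j).act_root hρ hij 1).act_eq_zero hp (Or.inl hne) hij.1 h2⟩
  have h3 := hu.height_eq hM hw
  rw [height_add, height_sub, height_wt, height_wt] at h3
  have h4 : ((rk ρ j - rk ρ i : ℤ) : ℂ) = 0 := by
    push_cast
    linear_combination -h3
  have h5 : rk ρ j - rk ρ i = 0 := by exact_mod_cast h4
  have := hij.1
  omega

/-- The new positive roots are old ones together with the negative of the reflected odd simple root.
The old ones kill f u by `KilledBelow`, and the new one does because f² = 0. -/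
theorem IsSingular.oddReflection (hρ : Function.Injective (rk ρ))
    (hu : M.IsSingular ρ μ u) (hp : parity i = 1 + parity j)
    (hij : IsAdjacent ρ i j) (hne : i.1 ≠ j.1) (hji' : rk ρ' i < rk ρ' j)
    (hρ' : ∀ a b, rk ρ' b < rk ρ' a →
      rk ρ b < rk ρ a ∨ (a = j ∧ b = i) ∨ (a = dual i ∧ b = dual j))
    (h0 : M.act 1 (root 1 j i) u ≠ 0) :
    M.IsSingular ρ' (μ + (wt j - wt i)) (M.act 1 (root 1 j i) u) := by
  refine ⟨h0, hu.homog.act M 1 _, hu.hasWt.act_root 1 j i, fun q A hA => ?_⟩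
  have hff : M.act 1 (root 1 j i) (M.act 1 (root 1 j i) u) = 0 := by
    -- The super bracket [f, f] is 2f² as an operator, and it vanishes since the matrix of f squares
    -- to zero.
    have h1 := M.act_act (root 1 j i) (root 1 j i) 0 (r := 0) (by decide)
      (by simp [superComm, root, rootMat_mul_self_of_fst_ne 1 (Ne.symm hne)]) u
    simp only [map_zero, LinearMap.zero_apply, zero_add, superSign_one_one, neg_smul,
      one_smul] at h1
    have h2 : (2 : ℂ) • M.act 1 (root 1 j i) (M.act 1 (root 1 j i) u) = 0 := by
      rw [two_smul]
      nth_rewrite 1 [h1]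
      simp
    exact (smul_eq_zero.1 h2).resolve_left (by norm_num)
  have hK := (hu.killedBelow i j).act_root hρ hij 1
  have hAij : (A : Mat m n) i j = 0 := by
    by_contra h
    exact absurd (hA _ _ h) (not_lt.2 hji'.le)
  have hup : ∀ B : osp m n q, (∀ k l, (B : Mat m n) k l ≠ 0 → rk ρ' l < rk ρ' k) →
      (B : Mat m n) j i = 0 → IsUpper ρ (B : Mat m n) := by
    intro B hB hz k l hkl
    rcases hρ' k l (hB k l hkl) with h | ⟨rfl, rfl⟩ | ⟨rfl, rfl⟩
    · exact h
    · exact absurd hz hkl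
    · exact absurd (entry_dual_eq_zero B hz) hkl
  by_cases hz : (A : Mat m n) j i = 0
  · exact hK q A (hup A hA hz) hAij
  · have hp' := parity_comm hp
    have hq : parity j = q + parity i := by
      by_contra h
      exact hz (A.2.1 j i h)
    obtain rfl : 1 = q := by
      rw [hp'] at hq
      exact add_right_cancel hq
    have hs := rootMat_entry_ne_zero hp' (Or.inl (Ne.symm hne))
    set s := rootMat 1 j i j i
    set B : osp m n 1 := A - ((A : Mat m n) j i / s) • root 1 j i
    have hB : M.act 1 B (M.act 1 (root 1 j i) u) = 0 := by
      have hB' : ∀ k l, (B : Mat m n) k l ≠ 0 → rk ρ' l < rk ρ' k := by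
        intro k l hkl
        by_cases h1 : (A : Mat m n) k l = 0
        · refine isUpper_rootMat hji' k l (p := 1) fun h2 => hkl ?_
          simp [B, root, h1, h2]
        · exact hA k l h1
      have hz' : (B : Mat m n) j i = 0 := by
        simp only [B, root, Submodule.coe_sub, Submodule.coe_smul, Matrix.sub_apply,
          Matrix.smul_apply, smul_eq_mul]
        rw [div_mul_cancel₀ _ hs, sub_self]
      refine hK 1 B (hup B hB' hz') ?_
      by_contra h
      exact absurd (hB' _ _ h) (not_lt.2 hji'.le)
    have hAB : A = B + ((A : Mat m n) j i / s) • root 1 j i := by simp [B]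
    rw [hAB, map_add, LinearMap.add_apply, hB, map_smul, LinearMap.smul_apply, hff]
    simp

theorem IsSingular.oddReflection_of_eq_zero
    (hu : M.IsSingular ρ μ u)
    (hρ' : ∀ a b, rk ρ' b < rk ρ' a →
      rk ρ b < rk ρ a ∨ (a = j ∧ b = i) ∨ (a = dual i ∧ b = dual j))
    (h0 : M.act 1 (root 1 j i) u = 0) (hp : parity i = 1 + parity j) (hne : i.1 ≠ j.1)
    (hji' : rk ρ' i < rk ρ' j) :
    M.IsSingular ρ' μ u := by
  refine ⟨hu.ne_zero, hu.homog, hu.hasWt, fun q A hA => ?_⟩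
  have hK : M.KilledBelow ρ' j i u := by
    intro q B hB hz
    refine hu.act_eq_zero q B fun k l hkl => ?_
    rcases hρ' k l (hB k l hkl) with h | ⟨rfl, rfl⟩ | ⟨rfl, rfl⟩
    · exact h
    · exact absurd hz hkl
    · exact absurd (entry_dual_eq_zero B hz) hkl
  exact hK.act_eq_zero (parity_comm hp) (Or.inl (Ne.symm hne)) hji' h0 q A hA

end OddReflection

/-- A homogeneous operator sends the even and odd components of v into different graded parts, so it
kills both if it kills v; one of the components is nonzero. This makes the highest weight vector
homogeneous. -/
theorem exists_homog_of_apply_eq_zero {v : V} (hv : v ≠ 0) : ∃ w : V, w ≠ 0 ∧ M.Homog w ∧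
    ∀ (p : ZMod 2) (T : Module.End ℂ V), (∀ q, ∀ x ∈ M.grade q, T x ∈ M.grade (p + q)) →
      T v = 0 → T w = 0 := by
  have h1 : M.grade 0 ⊔ M.grade 1 = ⊤ := by
    rw [eq_top_iff, ← M.grade_internal.submodule_iSup_eq_top, iSup_le_iff]
    intro p
    fin_cases p
    · exact le_sup_left
    · exact le_sup_right
  have h2 : ∀ p, Disjoint (M.grade (p + 0)) (M.grade (p + 1)) := fun p =>
    M.grade_internal.submodule_iSupIndep.pairwiseDisjoint (by simp)
  obtain ⟨a, ha, b, hb, rfl⟩ := Submodule.mem_sup.1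
    (h1 ▸ Submodule.mem_top : v ∈ M.grade 0 ⊔ M.grade 1)
  have h3 : ∀ (p : ZMod 2) (T : Module.End ℂ V),
      (∀ q, ∀ x ∈ M.grade q, T x ∈ M.grade (p + q)) → T (a + b) = 0 → T a = 0 ∧ T b = 0 := by
    intro p T hT h
    rw [map_add] at h
    have h4 : T a = 0 := Submodule.disjoint_def.1 (h2 p) _ (hT 0 a ha) (by
      rw [eq_neg_of_add_eq_zero_left h]
      exact Submodule.neg_mem _ (hT 1 b hb))
    exact ⟨h4, by simpa [h4] using h⟩
  by_cases h : a = 0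
  · subst h
    exact ⟨b, by simpa using hv, ⟨1, hb⟩, fun p T hT h => (h3 p T hT h).2⟩
  · exact ⟨a, h, ⟨0, ha⟩, fun p T hT h => (h3 p T hT h).1⟩

end SuperModule

/-! ### The chain of orders moving 1/2 past the integral labels -/

/-- The order on the labels after moving the label `1/2` past the first `k` integral ones. -/
def ord (m n k : ℕ) : Label m n → ℤ
  | Sum.inl j => if (j : ℕ) < k then m + 1 - j else m - j
  | Sum.inr i => if (i : ℕ) = 0 then m + 1 - k else m + 1 + i

theorem ord_injective {k : ℕ} (hk : k ≤ m) : Function.Injective (rk (ord m n k)) := by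
  rintro ⟨a | a, c⟩ ⟨b | b, d⟩ h <;> cases c <;> cases d <;>
    simp only [rk, ord, Bool.false_eq_true, if_true, if_false] at h <;>
    simp only [Prod.mk.injEq, Sum.inl.injEq, Sum.inr.injEq, Fin.ext_iff, and_true, reduceCtorEq,
      false_and, and_false] <;> split_ifs at h <;> omega

theorem ord_succ_lt {k : ℕ} (hk : k < m) {i : Fin n} (hi : (i : ℕ) = 0)
    (a b : BasisIndex m n) (h : rk (ord m n (k + 1)) b < rk (ord m n (k + 1)) a) :
    rk (ord m n k) b < rk (ord m n k) a ∨
      (a = (Sum.inl ⟨k, hk⟩, true) ∧ b = (Sum.inr i, true)) ∨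
      (a = dual (Sum.inr i, true) ∧ b = dual (Sum.inl ⟨k, hk⟩, true)) := by
  obtain ⟨a | a, c⟩ := a <;> obtain ⟨b | b, d⟩ := b <;> cases c <;> cases d <;>
    simp only [rk, ord, Bool.false_eq_true, if_true, if_false] at h ⊢ <;>
    simp only [dual, Prod.mk.injEq, Sum.inl.injEq, Sum.inr.injEq, Fin.ext_iff, and_true,
      reduceCtorEq, false_and, and_false, or_false, false_or, Bool.not_true, hi] <;>
    split_ifs at h ⊢ <;> omega

theorem isPositiveRoot_of_rk_lt {p : ZMod 2} {a b : BasisIndex m n}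
    (h : rk (ord m n 0) b < rk (ord m n 0) a) (h0 : rootMat p a b ≠ 0) :
    IsPositiveRoot (wt a - wt b) := by
  by_cases hab : a.1 = b.1
  · rcases eq_or_eq_dual hab with rfl | rfl
    · exact absurd h (lt_irrefl _)
    · by_cases hp : parity b = 0
      -- The difference of ranks would correspond to ±2ε_r with r integral, which is not a root: the
      -- two matrix units cancel.
      · refine absurd ?_ h0
        by_cases hp' : parity (dual b) = p + parity b
        · obtain rfl : p = 0 := by simpa using hp'
          have h1 : rootSign 0 (dual b) b = 1 := by
            rw [rootSign, gsign_dual, hp]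
            simpa using gsign_mul_self b
          rw [rootMat_of hp', h1]
          simp
        · rw [rootMat, if_neg hp']
      · obtain ⟨b | b, d⟩ := b
        · exact absurd rfl hp
        · have h1 : wt (dual (Sum.inr b, d) : BasisIndex m n) - wt (Sum.inr b, d) =
              -(2 : ℂ) • wt (Sum.inr b, d) := by
            rw [wt_dual, neg_smul, two_smul]
            abel
          rw [h1]
          cases d
          · exact .long b
          · simp only [rk, ord, dual] at h
            simp at h
            split_ifs at h <;> omega
  · have key : (LabelLT b.1 a.1 ∧ a.2 = true) ∨ (LabelLT a.1 b.1 ∧ b.2 = false) := by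
      obtain ⟨a | a, c⟩ := a <;> obtain ⟨b | b, d⟩ := b <;> cases c <;> cases d <;>
        simp only [rk, ord, LabelLT, Sum.inl.injEq, Sum.inr.injEq, Fin.ext_iff, Fin.lt_def,
          Bool.false_eq_true, if_true, if_false, and_true, and_false, or_false, false_or,
          Bool.true_eq_false, not_lt_zero, reduceCtorEq] at h hab ⊢ <;>
        (try split_ifs at h) <;> omega
    obtain ⟨a, c⟩ := a
    obtain ⟨b, d⟩ := b
    rcases key with ⟨hl, rfl⟩ | ⟨hl, rfl⟩
    · cases d
      · have : wt (a, true) - wt (b, false) = (-eps b - eps a : Weight m n) := by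
          simp [wt]
          abel
        rw [this]
        exact .neg _ _ hl
      · have : wt (a, true) - wt (b, true) = (eps b - eps a : Weight m n) := by
          simp [wt]
          abel
        rw [this]
        exact .sub _ _ hl
    · cases c
      · exact .sub _ _ hl
      · exact .neg _ _ hl

theorem SuperModule.HasHighestWeight.exists_isSingular {V : Type*} [AddCommGroup V] [Module ℂ V]
    {M : SuperModule m n V} {μ : Weight m n} (h : M.HasHighestWeight μ) :
    ∃ u, M.IsSingular (ord m n 0) μ u := by
  obtain ⟨v, hv, hwt, hk⟩ := h
  obtain ⟨w, hw, hhom, hT⟩ := M.exists_homog_of_apply_eq_zero hv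
  refine ⟨w, hw, hhom, fun r => ?_, fun p A hA => ?_⟩
  · have := hT 0 (M.act 0 (cartan r) - μ r • 1) (fun q x hx => ?_) (by simp [hwt r])
    · simpa [sub_eq_zero] using this
    · refine Submodule.sub_mem _ (M.act_mem 0 q _ x hx) ?_
      rw [zero_add]
      exact Submodule.smul_mem _ _ hx
  · refine hT p (M.act p A) (fun q x hx => M.act_mem p q A x hx) ?_
    rw [M.act_eq_sum_root, Finset.sum_eq_zero, smul_zero]
    intro a _
    refine Finset.sum_eq_zero fun b _ => ?_
    by_cases h0 : (A : Mat m n) a b = 0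
    · rw [h0, zero_smul]
    · by_cases h1 : rootMat p a b = 0
      · have : root p a b = 0 := Subtype.ext h1
        rw [this]
        simp
      · rw [hk p (root p a b) (wt a - wt b) (isPositiveRoot_of_rk_lt (hA a b h0) h1)
          (fun r => superComm_cartanMat_rootMat p r a b), smul_zero]

theorem wt_sub_apply_inr {k : Fin m} {i : Fin n} :
    (wt (Sum.inl k, true) - wt (Sum.inr i, true) : Weight m n) (Sum.inr i) = 1 := by
  simp [wt, eps]

theorem wt_sub_apply_inl {k l : Fin m} {i : Fin n} (h : l ≠ k) :
    (wt (Sum.inl k, true) - wt (Sum.inr i, true) : Weight m n) (Sum.inl l) = 0 := by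
  simp [wt, eps, h]

theorem parity_inr_eq (i : Fin n) (k : Fin m) :
    parity ((Sum.inr i, true) : BasisIndex m n) =
      1 + parity ((Sum.inl k, true) : BasisIndex m n) := by
  simp [parity, labelParity]

theorem isAdjacent_ord {k : ℕ} (hk : k < m) {i : Fin n} (hi : (i : ℕ) = 0) :
    IsAdjacent (ord m n k) (Sum.inr i, true) (Sum.inl ⟨k, hk⟩, true) := by
  have h1 : rk (ord m n k) (Sum.inr i, true) = m + 1 - k := by simp [rk, ord, hi]
  have h2 : rk (ord m n k) (Sum.inl ⟨k, hk⟩, true) = m - k := by simp [rk, ord]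
  rw [IsAdjacent, h1, h2]
  exact ⟨by omega, fun c hc => by omega⟩

theorem ord_succ_swap {k : ℕ} (hk : k < m) {i : Fin n} (hi : (i : ℕ) = 0) :
    rk (ord m n (k + 1)) (Sum.inr i, true) < rk (ord m n (k + 1)) (Sum.inl ⟨k, hk⟩, true) := by
  simp [rk, ord, hi]

/-! ### Dominance and the hook condition -/

/-- `μ` is the weight with coordinates `-b` and `-ν`, and these satisfy the dominance conditions
together with the hook condition. -/
structure IsDominant (μ : Weight m n) (b : Fin n → ℕ) (ν : Fin m → ℤ) : Prop where
  inr : ∀ i, μ (Sum.inr i) = -(b i : ℂ)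
  inl : ∀ j, μ (Sum.inl j) = -(ν j : ℂ)
  mono : ∀ i i', i < i' → b i ≤ b i'
  anti : ∀ j k, j < k → ν k ≤ ν j ∧ -ν k ≤ ν j
  hook : ∀ i : Fin n, (i : ℕ) = 0 → ∀ j : Fin m, b i ≤ j → ν j = 0

namespace SuperModule

variable {V : Type*} [AddCommGroup V] [Module ℂ V] {M : SuperModule m n V}
  {μ : Weight m n} {u : V}

theorem IsSingular.step_of_ne {k : ℕ} (hk : k < m) {i : Fin n} (hi : (i : ℕ) = 0)
    (hu : M.IsSingular (ord m n k) μ u)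
    (h : -μ (Sum.inr i) - μ (Sum.inl ⟨k, hk⟩) ≠ 0) :
    ∃ u', M.IsSingular (ord m n (k + 1))
      (μ + (wt (Sum.inl ⟨k, hk⟩, true) - wt (Sum.inr i, true))) u' := by
  have hp := parity_inr_eq i (⟨k, hk⟩ : Fin m)
  refine ⟨_, hu.oddReflection (ord_injective hk.le) hp (isAdjacent_ord hk hi) (by simp)
    (ord_succ_swap hk hi) (ord_succ_lt hk hi)
    (hu.act_odd_ne_zero hp (isAdjacent_ord hk hi).1 (by simp) ?_)⟩
  simpa [pairing, sub_eq_add_neg] using h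

theorem IsSingular.step_of_eq (hM : M.IsIrreducible) {k : ℕ} (hk : k < m) {i : Fin n}
    (hi : (i : ℕ) = 0) (hu : M.IsSingular (ord m n k) μ u)
    (h : -μ (Sum.inr i) - μ (Sum.inl ⟨k, hk⟩) = 0) : M.IsSingular (ord m n (k + 1)) μ u := by
  have hp := parity_inr_eq i (⟨k, hk⟩ : Fin m)
  refine hu.oddReflection_of_eq_zero (ord_succ_lt hk hi)
    (hu.act_odd_eq_zero hM (ord_injective hk.le) hp (isAdjacent_ord hk hi) (by simp) ?_) hp
    (by simp) (ord_succ_swap hk hi)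
  simpa [pairing, sub_eq_add_neg] using h

theorem isEvenPair_inr_long (i : Fin n) :
    IsEvenPair ((Sum.inr i, true) : BasisIndex m n) (Sum.inr i, false) :=
  ⟨rfl, Or.inr ⟨rfl, rfl⟩⟩

theorem isEvenPair_inr {i i' : Fin n} (h : i ≠ i') (c d : Bool) :
    IsEvenPair ((Sum.inr i, c) : BasisIndex m n) (Sum.inr i', d) :=
  ⟨rfl, Or.inl (by simpa using h)⟩

theorem isEvenPair_inl {i i' : Fin m} (h : i ≠ i') (c d : Bool) :
    IsEvenPair ((Sum.inl i, c) : BasisIndex m n) (Sum.inl i', d) :=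
  ⟨rfl, Or.inl (by simpa using h)⟩

/-- If ν_b ≠ 0, then each of the b + 1 odd reflections past the labels -1, …, -(b+1) changes the
weight, and the ε_{1/2} coordinate ends at 1, violating dominance for -2ε_{1/2}. -/
theorem IsSingular.hook [FiniteDimensional ℂ V] (hu : M.IsSingular (ord m n 0) μ u) {i : Fin n}
    (hi : (i : ℕ) = 0) {b : ℕ} (hb : μ (Sum.inr i) = -(b : ℂ)) {ν : Fin m → ℤ}
    (hν : ∀ j, μ (Sum.inl j) = -(ν j : ℂ)) (hbm : b < m) (hpos : ∀ j : Fin m, j < b → 0 < ν j) :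
    ν ⟨b, hbm⟩ = 0 := by
  by_contra hne
  have key : ∀ k ≤ b + 1, ∃ u' μ', M.IsSingular (ord m n k) μ' u' ∧
      μ' (Sum.inr i) = -((b : ℂ) - k) ∧ ∀ l : Fin m, k ≤ l → μ' (Sum.inl l) = -(ν l : ℂ) := by
    intro k
    induction k with
    | zero => exact fun _ => ⟨u, μ, hu, by simpa using hb, fun l _ => hν l⟩
    | succ k ih =>
      intro hk
      obtain ⟨u', μ', hu', h1, h2⟩ := ih (by omega)
      have hkm : k < m := by omega
      -- For k < b both b - k and ν_k are positive; for k = b the sum is ν_b itself.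
      have hsum : (b : ℤ) - k + ν ⟨k, hkm⟩ ≠ 0 := by
        rcases Nat.lt_or_ge k b with h | h
        · have := hpos ⟨k, hkm⟩ h
          omega
        · obtain rfl : k = b := by omega
          simpa using hne
      obtain ⟨w, hw⟩ := hu'.step_of_ne hkm hi (by
        rw [h1, h2 ⟨k, hkm⟩ le_rfl]
        have : (((b : ℤ) - k + ν ⟨k, hkm⟩ : ℤ) : ℂ) ≠ 0 := by exact_mod_cast hsum
        push_cast at this
        simpa using this)
      refine ⟨w, _, hw, ?_, fun l hl => ?_⟩
      · rw [Pi.add_apply, wt_sub_apply_inr, h1]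
        push_cast
        ring
      · rw [Pi.add_apply, wt_sub_apply_inl (by rintro rfl; simp at hl), h2 l (by omega), add_zero]
  obtain ⟨w, μ', hw, h1, -⟩ := key (b + 1) le_rfl
  -- In the order `ord m n (b + 1)` the label 1/2 has rank m - b > 0, so -2ε_{1/2} is still
  -- positive; its coroot value is now -1.
  obtain ⟨N, hN⟩ := hw.exists_pairVal_eq_nat (isEvenPair_inr_long i) (by
    simp [rk, ord, hi]
    omega)
  have h3 : pairVal (Sum.inr i, true) (Sum.inr i, false) μ' = -μ' (Sum.inr i) := by
    simp [pairVal, pairing]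
  rw [h3, h1] at hN
  push_cast at hN
  have h4 : ((N + 1 : ℕ) : ℂ) = 0 := by
    push_cast
    linear_combination -hN
  exact Nat.cast_ne_zero.2 (Nat.succ_ne_zero N) h4

theorem IsSingular.exists_isDominant [FiniteDimensional ℂ V] (hu : M.IsSingular (ord m n 0) μ u)
    (hμ : IsIntegral μ) : ∃ b ν, IsDominant μ b ν := by
  have hb : ∀ i : Fin n, ∃ N : ℕ, μ (Sum.inr i) = -(N : ℂ) := by
    intro i
    obtain ⟨N, hN⟩ := hu.exists_pairVal_eq_nat (isEvenPair_inr_long i) (by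
      simp [rk, ord]
      split_ifs <;> omega)
    refine ⟨N, ?_⟩
    rw [← hN]
    simp [pairVal, pairing]
  choose b hb using hb
  have hν : ∀ j : Fin m, ∃ z : ℤ, μ (Sum.inl j) = -(z : ℂ) := by
    intro j
    obtain ⟨z, hz⟩ := hμ (Sum.inl j)
    exact ⟨-z, by simp [hz]⟩
  choose ν hν using hν
  have anti : ∀ j k, j < k → ν k ≤ ν j ∧ -ν k ≤ ν j := by
    intro j k hjk
    constructor
    · obtain ⟨N, hN⟩ := hu.exists_pairVal_eq_nat (isEvenPair_inl hjk.ne true true) (by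
        simp [rk, ord]
        omega)
      simp [pairVal, pairing, hjk.ne, hν] at hN
      have : ν j - ν k = N := by exact_mod_cast hN
      omega
    · obtain ⟨N, hN⟩ := hu.exists_pairVal_eq_nat (isEvenPair_inl hjk.ne true false) (by
        simp [rk, ord]
        omega)
      simp [pairVal, pairing, hjk.ne, hν] at hN
      have : ν j + ν k = N := by exact_mod_cast hN
      omega
  refine ⟨b, ν, hb, hν, fun i i' hii => ?_, anti, fun i hi j hj => ?_⟩
  · obtain ⟨N, hN⟩ := hu.exists_pairVal_eq_nat (isEvenPair_inr hii.ne' true true) (by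
      simp [rk, ord]
      split_ifs <;> omega)
    simp [pairVal, pairing, hii.ne', hb] at hN
    have : (b i' : ℤ) - b i = N := by exact_mod_cast hN
    omega
  · by_contra hne
    have hbm : b i < m := by omega
    -- Since ν_b ≥ |ν_j| for b < j, a nonzero ν_j beyond b forces ν_b ≠ 0, and likewise ν_l > 0 for
    -- l < b.
    have hne' : ν ⟨b i, hbm⟩ ≠ 0 := by
      rcases Nat.lt_or_ge (b i) j with h | h
      · have := anti ⟨b i, hbm⟩ j h
        omega
      · obtain rfl : j = ⟨b i, hbm⟩ := Fin.ext (le_antisymm h hj)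
        exact hne
    refine hne' (hu.hook hi (hb i) hν hbm fun l hl => ?_)
    have := anti l ⟨b i, hbm⟩ hl
    omega

/-- The value c at ε_{1/2} drops by at most one per reflection, which is recorded as b_0 ≤ c + k. It
cannot become negative: once c = 0 the hook condition gives ν_k = 0. -/
theorem IsSingular.exists_isSingular_ord_last (hM : M.IsIrreducible)
    (hu : M.IsSingular (ord m n 0) μ u) {b : Fin n → ℕ} {ν : Fin m → ℤ} (h : IsDominant μ b ν)
    {i : Fin n} (hi : (i : ℕ) = 0) :
    ∃ u' μ', M.IsSingular (ord m n m) μ' u' ∧ ∃ N : ℕ, μ' (Sum.inr i) = -(N : ℂ) := by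
  have key : ∀ k ≤ m, ∃ u' μ', M.IsSingular (ord m n k) μ' u' ∧
      (∃ c : ℕ, μ' (Sum.inr i) = -(c : ℂ) ∧ b i ≤ c + k) ∧
      ∀ l : Fin m, k ≤ l → μ' (Sum.inl l) = -(ν l : ℂ) := by
    intro k
    induction k with
    | zero => exact fun _ => ⟨u, μ, hu, ⟨b i, h.inr i, le_rfl⟩, fun l _ => h.inl l⟩
    | succ k ih =>
      intro hk
      obtain ⟨u', μ', hu', ⟨c, h1, hc⟩, h2⟩ := ih (by omega)
      by_cases hsum : -μ' (Sum.inr i) - μ' (Sum.inl ⟨k, hk⟩) = 0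
      · exact ⟨u', μ', hu'.step_of_eq hM hk hi hsum, ⟨c, h1, by omega⟩,
          fun l hl => h2 l (by omega)⟩
      · obtain ⟨w, hw⟩ := hu'.step_of_ne hk hi hsum
        refine ⟨w, _, hw, ?_, fun l hl => ?_⟩
        -- With c = 0 the invariant reads b_0 ≤ k, so ν_k = 0 and the pairing vanishes, contrary to
        -- `hsum`.
        · cases c with
          | zero =>
            refine absurd ?_ hsum
            rw [h1, h2 ⟨k, hk⟩ le_rfl, h.hook i hi ⟨k, hk⟩ (by simpa using hc)]
            simp
          | succ c =>
            refine ⟨c, ?_, by omega⟩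
            rw [Pi.add_apply, wt_sub_apply_inr, h1]
            push_cast
            ring
        · rw [Pi.add_apply, wt_sub_apply_inl (by rintro rfl; simp at hl), h2 l (by omega),
            add_zero]
  obtain ⟨u', μ', hu', ⟨c, hc, -⟩, -⟩ := key m le_rfl
  exact ⟨u', μ', hu', c, hc⟩

end SuperModule

/-! ### Local nilpotency and commutators -/

section LocallyNilpotent

variable {V : Type*} [AddCommGroup V] [Module ℂ V]

/-- Every vector is killed by a power of `X`. -/
def LocNil (X : Module.End ℂ V) : Prop := ∀ u, ∃ N : ℕ, (X ^ N) u = 0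

theorem LocNil.smul {X : Module.End ℂ V} (hX : LocNil X) (c : ℂ) : LocNil (c • X) := by
  intro u
  obtain ⟨N, hN⟩ := hX u
  exact ⟨N, by rw [smul_pow, LinearMap.smul_apply, hN, smul_zero]⟩

theorem pow_apply_eq_zero_of_le {X : Module.End ℂ V} {u : V} {N K : ℕ} (h : (X ^ N) u = 0)
    (hNK : N ≤ K) : (X ^ K) u = 0 := by
  obtain ⟨d, rfl⟩ := Nat.exists_eq_add_of_le hNK
  rw [add_comm, pow_add, Module.End.mul_apply, h, map_zero]

/-- The inner derivation of the endomorphism algebra attached to `X`. -/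
def innerDer (X W : Module.End ℂ V) : Module.End ℂ V := X * W - W * X

theorem innerDer_iterate_mul {X Y Z : Module.End ℂ V} (h : X * Y - Y * X = Z) (hXZ : X * Z = Z * X)
    (W : Module.End ℂ V) (k : ℕ) : (innerDer X)^[k + 1] (Y * W) =
      Y * (innerDer X)^[k + 1] W + ((k + 1 : ℕ) : ℂ) • (Z * (innerDer X)^[k] W) := by
  have h' : X * Y = Z + Y * X := by rw [← h]; abel
  have hY : ∀ T, innerDer X (Y * T) = Y * innerDer X T + Z * T := by
    intro T
    rw [innerDer, innerDer, ← mul_assoc X, h', add_mul, mul_sub]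
    simp only [mul_assoc]
    abel
  have hZ : ∀ T, innerDer X (Z * T) = Z * innerDer X T := by
    intro T
    rw [innerDer, innerDer, ← mul_assoc X, hXZ, mul_sub]
    simp only [mul_assoc]
  have hs : ∀ (c : ℂ) A B, innerDer X (A + c • B) = innerDer X A + c • innerDer X B := by
    intro c A B
    simp only [innerDer, mul_add, add_mul, mul_smul_comm, smul_mul_assoc, smul_sub]
    abel
  induction k with
  | zero => simp [hY]
  | succ k ih =>
    rw [Function.iterate_succ_apply', ih, hs, hY, hZ, ← Function.iterate_succ_apply' (innerDer X),
      ← Function.iterate_succ_apply' (innerDer X), add_assoc]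
    congr 1
    push_cast
    rw [add_smul, add_smul, add_smul, one_smul]
    abel

/-- The derivation D = ad X satisfies DY = Z and DZ = 0, so it acts on powers of Y as
differentiation acts on a polynomial of degree N. -/
theorem innerDer_iterate_pow {X Y Z : Module.End ℂ V} (h : X * Y - Y * X = Z)
    (hXZ : X * Z = Z * X) (N : ℕ) : (innerDer X)^[N] (Y ^ N) = (N.factorial : ℂ) • Z ^ N ∧
      (innerDer X)^[N + 1] (Y ^ N) = 0 := by
  induction N with
  | zero => simp [innerDer]
  | succ N ih =>
    rw [pow_succ', innerDer_iterate_mul h hXZ, innerDer_iterate_mul h hXZ, ih.1, ih.2,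
      Function.iterate_succ_apply' (n := N + 1), ih.2]
    refine ⟨?_, by simp [innerDer]⟩
    rw [mul_zero, zero_add, mul_smul_comm, smul_smul, ← pow_succ', Nat.factorial_succ]
    push_cast
    rfl

/-- A power Y^K killing all the vectors X^k u is also killed at u after any number of applications
of ad X; after K of them it has become K! Z^K. -/
theorem LocNil.commutator {X Y Z : Module.End ℂ V} (hX : LocNil X) (hY : LocNil Y)
    (h : X * Y - Y * X = Z) (hXZ : X * Z = Z * X) : LocNil Z := by
  intro u
  obtain ⟨a, ha⟩ := hX u
  choose N hN using fun k => hY ((X ^ k) u)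
  -- Only the finitely many nonzero X^k u matter, so one exponent serves all of them.
  set K := (Finset.range a).sup N
  have h1 : ∀ k, (Y ^ K) ((X ^ k) u) = 0 := by
    intro k
    rcases Nat.lt_or_ge k a with hk | hk
    · exact pow_apply_eq_zero_of_le (hN k) (Finset.le_sup (Finset.mem_range.2 hk))
    · rw [pow_apply_eq_zero_of_le ha hk, map_zero]
  have h2 : ∀ l k, ((innerDer X)^[l] (Y ^ K)) ((X ^ k) u) = 0 := by
    intro l
    induction l with
    | zero => exact h1
    | succ l ih =>
      intro k
      rw [Function.iterate_succ_apply', innerDer, LinearMap.sub_apply, Module.End.mul_apply,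
        Module.End.mul_apply, ih, map_zero, ← Module.End.mul_apply X, ← pow_succ', ih, sub_zero]
  refine ⟨K, ?_⟩
  have h3 := h2 K 0
  rw [(innerDer_iterate_pow h hXZ K).1, LinearMap.smul_apply, pow_zero, Module.End.one_apply] at h3
  exact (smul_eq_zero.1 h3).resolve_left (Nat.cast_ne_zero.2 K.factorial_ne_zero)

theorem exists_pow_eq_zero_of_commutator {X Y Y' : Module.End ℂ V}
    (h : ∀ u, X (Y u) = Y (X u) + Y' u)
    (hY' : ∀ u, (∃ N : ℕ, (X ^ N) u = 0) → ∃ N : ℕ, (X ^ N) (Y' u) = 0) (u : V)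
    (hu : ∃ N : ℕ, (X ^ N) u = 0) : ∃ N : ℕ, (X ^ N) (Y u) = 0 := by
  obtain ⟨N, hN⟩ := hu
  induction N generalizing u with
  | zero =>
    obtain rfl : u = 0 := by simpa using hN
    exact ⟨0, by simp⟩
  | succ N ih =>
    obtain ⟨a, ha⟩ := ih (X u) (by rwa [pow_succ] at hN)
    obtain ⟨b, hb⟩ := hY' u ⟨_, hN⟩
    refine ⟨max a b + 1, ?_⟩
    rw [pow_succ, Module.End.mul_apply, h, map_add, pow_apply_eq_zero_of_le ha (le_max_left _ _),
      pow_apply_eq_zero_of_le hb (le_max_right _ _), add_zero]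

end LocallyNilpotent

namespace SuperModule

variable {V : Type*} [AddCommGroup V] [Module ℂ V] {M : SuperModule m n V}
  {μ : Weight m n} {u : V}

/-- The matrix of x squares to zero, so (ad x)³ = 0 and three commutations suffice. Thus the vectors
killed by a power of x form a submodule. -/
theorem exists_pow_act_eq_zero {a b : BasisIndex m n} (hab : a ≠ b) (p : ZMod 2) (y : osp m n p)
    (u : V) (hu : ∃ N : ℕ, (M.act 0 (root 0 a b) ^ N) u = 0) :
    ∃ N : ℕ, (M.act 0 (root 0 a b) ^ N) (M.act p y u) = 0 := by
  set x := root 0 a b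
  have hx : (x : Mat m n) * x = 0 := rootMat_mul_self hab
  have mem : ∀ z : osp m n p, superComm 0 p (x : Mat m n) z ∈ osp m n p := fun z => by
    simpa using superComm_mem x.2 z.2
  have hc : ∀ (z : osp m n p) (u : V), M.act 0 x (M.act p z u) =
      M.act p z (M.act 0 x u) + M.act p ⟨_, mem z⟩ u := by
    intro z u
    rw [M.act_act x z ⟨_, mem z⟩ (zero_add p).symm rfl, superSign_zero_left, one_smul, add_comm]
  refine exists_pow_eq_zero_of_commutator (hc y) (fun u hu => ?_) u hu
  refine exists_pow_eq_zero_of_commutator (hc _) (fun u hu => ?_) u hu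
  refine exists_pow_eq_zero_of_commutator (hc _) (fun u hu => ?_) u hu
  refine ⟨0, ?_⟩
  have h0 : (⟨_, mem ⟨_, mem ⟨_, mem y⟩⟩⟩ : osp m n p) = 0 := by
    apply Subtype.ext
    have e1 : ∀ A : Mat m n, (x : Mat m n) * (x * A) = 0 := fun A => by
      rw [← Matrix.mul_assoc, hx, Matrix.zero_mul]
    simp [superComm, Matrix.mul_sub, Matrix.sub_mul, Matrix.mul_assoc, hx, e1]
  rw [h0]
  simp

theorem locNil_of_exists (hM : M.IsIrreducible) {a b : BasisIndex m n} (hab : a ≠ b)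
    (h : ∃ u ≠ 0, M.Homog u ∧ ∃ N : ℕ, (M.act 0 (root 0 a b) ^ N) u = 0) :
    LocNil (M.act 0 (root 0 a b)) := by
  set X := M.act 0 (root 0 a b)
  have h1 : Submodule.span ℂ {u : V | M.Homog u ∧ ∃ N : ℕ, (X ^ N) u = 0} = ⊤ := by
    refine hM.span_eq_top (fun s hs => hs.1) ?_ fun s hs p c d => Submodule.subset_span
      ⟨hs.1.act M p _, exists_pow_act_eq_zero hab p _ s hs.2⟩
    obtain ⟨u, hu, h2, h3⟩ := h
    exact ⟨u, ⟨h2, h3⟩, hu⟩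
  have h2 : (⊤ : Submodule ℂ V) ≤ X.maxGenEigenspace 0 := by
    rw [← h1, Submodule.span_le]
    rintro s ⟨-, N, hN⟩
    exact (X.mem_maxGenEigenspace 0 s).2 ⟨N, by simpa using hN⟩
  intro u
  simpa using (X.mem_maxGenEigenspace 0 u).1 (h2 trivial)

theorem IsSingular.locNil_of_lt (hM : M.IsIrreducible) {ρ : Label m n → ℤ}
    (hu : M.IsSingular ρ μ u) {a b : BasisIndex m n} (hab : rk ρ b < rk ρ a) :
    LocNil (M.act 0 (root 0 a b)) :=
  locNil_of_exists hM (by rintro rfl; exact lt_irrefl _ hab) ⟨u, hu.ne_zero, hu.homog, 1, by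
    simpa using hu.act_eq_zero 0 _ (isUpper_rootMat hab)⟩

theorem IsSingular.locNil_of_isAdjacent (hM : M.IsIrreducible) {ρ : Label m n → ℤ}
    (hρ : Function.Injective (rk ρ)) (hu : M.IsSingular ρ μ u) {i j : BasisIndex m n}
    (h : IsEvenPair i j) (hij : IsAdjacent ρ i j) (hN : ∃ N : ℕ, pairVal i j μ = N) :
    LocNil (M.act 0 (root 0 j i)) := by
  obtain ⟨N, hN⟩ := hN
  exact locNil_of_exists hM (by rintro rfl; exact lt_irrefl _ hij.1)
    ⟨u, hu.ne_zero, hu.homog, N + 1, hu.root_pow_eq_zero hM hρ h hij hN⟩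

theorem locNil_dual {a b : BasisIndex m n} (h : parity a = parity b)
    (hab : LocNil (M.act 0 (root 0 a b))) : LocNil (M.act 0 (root 0 (dual b) (dual a))) := by
  have : root 0 (dual b) (dual a) = -rootSign 0 a b • root 0 a b :=
    Subtype.ext (rootMat_dual_dual h)
  rw [this, map_smul]
  exact hab.smul _

theorem act_commutator {x y z : osp m n 0} (h : superComm 0 0 (x : Mat m n) y = z) :
    M.act 0 x * M.act 0 y - M.act 0 y * M.act 0 x = M.act 0 z := by
  ext u
  rw [LinearMap.sub_apply, Module.End.mul_apply, Module.End.mul_apply,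
    M.act_act x y z (zero_add 0).symm h]
  simp

/-- Local nilpotency passes to sums of roots. The second alternative of `h4` admits a long root as
first factor, where the bracket carries an extra factor 2. -/
theorem locNil_trans {a b c : BasisIndex m n} (hab : parity a = parity b)
    (hbc : parity b = parity c) (h1 : a ≠ b) (h3 : a ≠ c) (h5 : b ≠ dual c)
    (h4 : b ≠ dual a ∨ parity b = 1)
    (hX : LocNil (M.act 0 (root 0 a b))) (hY : LocNil (M.act 0 (root 0 b c))) :
    LocNil (M.act 0 (root 0 a c)) := by
  have hcomm : M.act 0 (root 0 a b) * M.act 0 (root 0 a c) =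
      M.act 0 (root 0 a c) * M.act 0 (root 0 a b) := by
    have := act_commutator (M := M) (x := root 0 a b) (y := root 0 a c) (z := 0)
      (superComm_root_same_left hab hbc h1 h3 h5)
    rw [map_zero] at this
    exact sub_eq_zero.1 this
  by_cases h : b = dual a
  · have hb := h4.resolve_left (not_not.2 h)
    obtain rfl : a = dual b := by rw [h, dual_dual]
    have h6 := act_commutator (M := M) (x := root 0 (dual b) b) (y := root 0 b c)
      (z := (2 : ℂ) • root 0 (dual b) c) (superComm_root_chain_long hb hbc h5)
    have h7 := (hX.commutator hY h6 (by rw [map_smul, mul_smul_comm, hcomm, smul_mul_assoc])).smul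
      (2⁻¹ : ℂ)
    simpa [smul_smul] using h7
  · exact hX.commutator hY (act_commutator (superComm_root_chain hab hbc h3 h h5)) hcomm

theorem locNil_of_eq_zero {a b : BasisIndex m n} (h : rootMat 0 a b = 0) :
    LocNil (M.act 0 (root 0 a b)) := by
  have : root 0 a b = 0 := Subtype.ext h
  rw [this, map_zero]
  exact fun u => ⟨1, by simp⟩

end SuperModule

/-! ### Local nilpotency of all even root vectors -/

theorem entry_dual_self_eq_zero {p : ZMod 2} (A : osp m n p) {b : BasisIndex m n}
    (hb : parity b = 0) : (A : Mat m n) (dual b) b = 0 := by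
  by_cases hp : parity (dual b) = p + parity b
  · obtain rfl : p = 0 := by simpa using hp
    have h := (mem_osp_iff_entries.1 A.2).2 b (dual b)
    rw [gsign_dual, hb, dual_dual] at h
    simp only [superSign_zero_left, one_mul, gsign_mul_self] at h
    have h2 : (2 : ℂ) * (A : Mat m n) (dual b) b = 0 := by linear_combination h
    exact (mul_eq_zero.1 h2).resolve_left (by norm_num)
  · exact A.2.1 _ _ hp

theorem rootMat_dual_self_eq_zero {b : BasisIndex m n} (hb : parity b = 0) :
    rootMat 0 (dual b) b = 0 := by
  ext k l
  by_contra h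
  have h0 := entry_dual_self_eq_zero (root 0 (dual b) b) hb
  rcases rootMat_support h with ⟨rfl, rfl⟩ | ⟨rfl, rfl⟩
  · exact h h0
  · exact h (by rw [dual_dual]; exact h0)

/-- A second order on the labels giving the same Borel subalgebra as `ord m n 0`. -/
def ordFork (m n : ℕ) : Label m n → ℤ
  | Sum.inl j => if (j : ℕ) + 1 = m then -1 else m - j
  | Sum.inr i => m + 1 + i

theorem ordFork_injective : Function.Injective (rk (ordFork m n)) := by
  rintro ⟨a | a, c⟩ ⟨b | b, d⟩ h <;> cases c <;> cases d <;>
    simp only [rk, ordFork, Bool.false_eq_true, if_true, if_false] at h <;>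
    simp only [Prod.mk.injEq, Sum.inl.injEq, Sum.inr.injEq, Fin.ext_iff, and_true, reduceCtorEq,
      false_and, and_false] <;> (try split_ifs at h) <;> omega

theorem ordFork_lt (a b : BasisIndex m n) (h : rk (ordFork m n) b < rk (ordFork m n) a) :
    rk (ord m n 0) b < rk (ord m n 0) a ∨ (a = dual b ∧ parity b = 0) := by
  obtain ⟨a | a, c⟩ := a <;> obtain ⟨b | b, d⟩ := b <;> cases c <;> cases d <;>
    simp only [rk, ordFork, ord, Bool.false_eq_true, if_true, if_false] at h ⊢ <;>
    simp only [dual, Prod.mk.injEq, Sum.inl.injEq, Sum.inr.injEq, Fin.ext_iff, and_true,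
      reduceCtorEq, false_and, and_false, or_false, false_or, Bool.not_true, parity,
      labelParity, Bool.not_false] <;>
    (try split_ifs at h ⊢) <;> omega

/-- Changing the sign of the rank of -m reverses only the comparison of v_{-m} with its dual, and
the matrices of osp(2m|2n) have no entry there. The new ranking makes the fork root -ε_{-m} -
ε_{-m+1} a difference of adjacent ranks. -/
theorem SuperModule.IsSingular.ordFork {V : Type*} [AddCommGroup V] [Module ℂ V]
    {M : SuperModule m n V} {μ : Weight m n} {u : V} (hu : M.IsSingular (ord m n 0) μ u) :
    M.IsSingular (ordFork m n) μ u := by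
  refine ⟨hu.ne_zero, hu.homog, hu.hasWt, fun p A hA => hu.act_eq_zero p A fun a b hab => ?_⟩
  rcases ordFork_lt a b (hA a b hab) with h | ⟨rfl, h⟩
  · exact h
  · exact absurd (entry_dual_self_eq_zero A h) hab

namespace SuperModule

variable {V : Type*} [AddCommGroup V] [Module ℂ V] {M : SuperModule m n V}
  {μ : Weight m n} {u : V} {b : Fin n → ℕ} {ν : Fin m → ℤ}

theorem IsSingular.locNil_inr_of_lt (hM : M.IsIrreducible) (hu : M.IsSingular (ord m n 0) μ u)
    (hd : IsDominant μ b ν) {i i' : Fin n} (h : i < i') :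
    LocNil (M.act 0 (root 0 (Sum.inr i, true) (Sum.inr i', true))) := by
  have simple : ∀ (k : ℕ) (hk : k + 1 < n), LocNil (M.act 0 (root 0
      (Sum.inr ⟨k, (Nat.lt_succ_self k).trans hk⟩, true) (Sum.inr ⟨k + 1, hk⟩, true))) := by
    intro k hk
    have hne : (⟨k + 1, hk⟩ : Fin n) ≠ ⟨k, (Nat.lt_succ_self k).trans hk⟩ := by simp
    refine hu.locNil_of_isAdjacent hM (ord_injective (Nat.zero_le m)) (isEvenPair_inr hne _ _) ?_ ?_
    · have h1 : rk (ord m n 0) (Sum.inr ⟨k + 1, hk⟩, true) = m + 1 + (k + 1) := by simp [rk, ord]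
      have h2 : rk (ord m n 0) (Sum.inr ⟨k, (Nat.lt_succ_self k).trans hk⟩, true) = m + 1 + k := by
        simp [rk, ord]
      rw [IsAdjacent, h1, h2]
      exact ⟨by omega, fun c hc => by omega⟩
    · obtain ⟨d, hd'⟩ := Nat.exists_eq_add_of_le (hd.mono ⟨k, (Nat.lt_succ_self k).trans hk⟩
        ⟨k + 1, hk⟩ (by simp))
      refine ⟨d, ?_⟩
      simp [pairVal, pairing, hd.inr, hd']
  have key : ∀ k, (i : ℕ) + 1 ≤ k → ∀ hk : k < n, LocNil (M.act 0 (root 0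
      (Sum.inr i, true) (Sum.inr ⟨k, hk⟩, true))) := by
    intro k hk
    induction k, hk using Nat.le_induction with
    | base => exact fun hk => simple i hk
    | succ k hik ih =>
      intro hk
      refine locNil_trans (b := (Sum.inr ⟨k, (Nat.lt_succ_self k).trans hk⟩, true)) rfl rfl ?_ ?_
        ?_ (Or.inr rfl) (ih _) (simple k hk)
      · simp [Fin.ext_iff]
        omega
      · simp [Fin.ext_iff]
        omega
      · simp [dual]
  exact key i' h i'.2

/-- The case i = i' = 0 is the long root made simple in `ord m n m`. Brackets with the roots of
`locNil_inr_of_lt` then raise one index, duality exchanges the two, and brackets raise the other. -/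
theorem IsSingular.locNil_inr_neg (hM : M.IsIrreducible) (hu : M.IsSingular (ord m n 0) μ u)
    (hd : IsDominant μ b ν) (i i' : Fin n) :
    LocNil (M.act 0 (root 0 (Sum.inr i, false) (Sum.inr i', true))) := by
  have hn : 0 < n := lt_of_le_of_lt (Nat.zero_le _) i.2
  set o : Fin n := ⟨0, hn⟩
  have pos : ∀ k : Fin n, k ≠ o → o < k := fun k hk => by
    rw [Fin.lt_def]
    rw [Ne, Fin.ext_iff] at hk
    exact Nat.pos_of_ne_zero hk
  have h0 : LocNil (M.act 0 (root 0 (Sum.inr o, false) (Sum.inr o, true))) := by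
    obtain ⟨u', μ', hu', N, hN⟩ := hu.exists_isSingular_ord_last hM hd (i := o) rfl
    refine hu'.locNil_of_isAdjacent hM (ord_injective le_rfl) (isEvenPair_inr_long o) ?_ ⟨N, ?_⟩
    · have h1 : rk (ord m n m) (Sum.inr o, true) = 1 := by simp [rk, ord, o]
      have h2 : rk (ord m n m) (Sum.inr o, false) = -1 := by simp [rk, ord, o]
      rw [IsAdjacent, h1, h2]
      refine ⟨by norm_num, fun c hc => ?_⟩
      obtain ⟨c | c, d⟩ := c <;> cases d <;>
        simp only [rk, ord, Bool.false_eq_true, if_true, if_false] at hc ⊢ <;>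
        split_ifs at hc ⊢ <;> omega
    · simp [pairVal, pairing, hN]
  have h1 : ∀ k, LocNil (M.act 0 (root 0 (Sum.inr o, false) (Sum.inr k, true))) := by
    intro k
    by_cases hk : k = o
    · rw [hk]
      exact h0
    · exact locNil_trans (b := (Sum.inr o, true)) rfl rfl (by simp) (by simp) (by simp [dual])
        (Or.inr rfl) h0 (hu.locNil_inr_of_lt hM hd (pos k hk))
  have h2 : ∀ k, LocNil (M.act 0 (root 0 (Sum.inr k, false) (Sum.inr o, true))) := fun k =>
    locNil_dual (a := (Sum.inr o, false)) (b := (Sum.inr k, true)) rfl (h1 k)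
  by_cases hi' : i' = o
  · rw [hi']
    exact h2 i
  · exact locNil_trans (b := (Sum.inr o, true)) rfl rfl (by simp) (by simp) (by simp [dual])
        (Or.inr rfl) (h2 i) (hu.locNil_inr_of_lt hM hd (pos i' hi'))

theorem IsSingular.locNil_inl_of_lt (hM : M.IsIrreducible) (hu : M.IsSingular (ord m n 0) μ u)
    (hd : IsDominant μ b ν) {j k : Fin m} (h : j < k) :
    LocNil (M.act 0 (root 0 (Sum.inl k, true) (Sum.inl j, true))) := by
  have simple : ∀ (k : ℕ) (hk : k + 1 < m), LocNil (M.act 0 (root 0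
      (Sum.inl ⟨k + 1, hk⟩, true) (Sum.inl ⟨k, (Nat.lt_succ_self k).trans hk⟩, true))) := by
    intro k hk
    have hne : (⟨k, (Nat.lt_succ_self k).trans hk⟩ : Fin m) ≠ ⟨k + 1, hk⟩ := by simp
    refine hu.locNil_of_isAdjacent hM (ord_injective (Nat.zero_le m)) (isEvenPair_inl hne _ _) ?_ ?_
    · have h1 : rk (ord m n 0) (Sum.inl ⟨k + 1, hk⟩, true) = m - (k + 1) := by simp [rk, ord]
      have h2 : rk (ord m n 0) (Sum.inl ⟨k, (Nat.lt_succ_self k).trans hk⟩, true) = m - k := by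
        simp [rk, ord]
      rw [IsAdjacent, h1, h2]
      exact ⟨by omega, fun c hc => by omega⟩
    · obtain ⟨d, hd'⟩ := Int.le.dest (hd.anti ⟨k, (Nat.lt_succ_self k).trans hk⟩
        ⟨k + 1, hk⟩ (by simp)).1
      refine ⟨d, ?_⟩
      simp [pairVal, pairing, hd.inl, ← hd']
  have key : ∀ k, (j : ℕ) + 1 ≤ k → ∀ hk : k < m, LocNil (M.act 0 (root 0
      (Sum.inl ⟨k, hk⟩, true) (Sum.inl j, true))) := by
    intro k hk
    induction k, hk using Nat.le_induction with
    | base => exact fun hk => simple j hk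
    | succ k hik ih =>
      intro hk
      refine locNil_trans (b := (Sum.inl ⟨k, (Nat.lt_succ_self k).trans hk⟩, true)) rfl rfl ?_ ?_
        ?_ (Or.inl ?_) (simple k hk) (ih _)
      · simp [Fin.ext_iff]
      · simp [Fin.ext_iff]
        omega
      · simp [dual]
      · simp [dual]
  exact key k h k.2

/-- The same propagation as in `locNil_inr_neg`, started from the fork root instead of the long
root. -/
theorem IsSingular.locNil_inl_neg (hM : M.IsIrreducible) (hu : M.IsSingular (ord m n 0) μ u)
    (hd : IsDominant μ b ν) {k j : Fin m} (hkj : k ≠ j) :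
    LocNil (M.act 0 (root 0 (Sum.inl k, false) (Sum.inl j, true))) := by
  obtain ⟨l, rfl⟩ : ∃ l, m = l + 2 := by
    have h1 := k.2
    have h2 := j.2
    rw [Ne, Fin.ext_iff] at hkj
    exact ⟨m - 2, by omega⟩
  set o : Fin (l + 2) := Fin.last (l + 1)
  set o' : Fin (l + 2) := ⟨l, by omega⟩
  have ho : o' < o := by simp [o, o', Fin.lt_def]
  have pos : ∀ k, k ≠ o → k < o := fun k hk => Fin.lt_last_iff_ne_last.2 hk
  have h0 : LocNil (M.act 0 (root 0 (Sum.inl o, false) (Sum.inl o', true))) := by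
    refine hu.ordFork.locNil_of_isAdjacent hM ordFork_injective
      (isEvenPair_inl ho.ne _ _) ?_ ?_
    · have h1 : rk (OrthoSymplectic.ordFork (l + 2) n) (Sum.inl o', true) = 2 := by
        simp [rk, OrthoSymplectic.ordFork, o']
      have h2 : rk (OrthoSymplectic.ordFork (l + 2) n) (Sum.inl o, false) = 1 := by
        simp [rk, OrthoSymplectic.ordFork, o]
      rw [IsAdjacent, h1, h2]
      exact ⟨by norm_num, fun c hc => by omega⟩
    · obtain ⟨d, hd'⟩ := Int.le.dest (hd.anti o' o ho).2
      refine ⟨d, ?_⟩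
      have : ν o' = -ν o + d := hd'.symm
      simp [pairVal, pairing, hd.inl, this, ho.ne]
  have h1 : ∀ k, k ≠ o → LocNil (M.act 0 (root 0 (Sum.inl o, false) (Sum.inl k, true))) := by
    intro k hk
    by_cases hk' : k = o'
    · rw [hk']
      exact h0
    · have hlt : k < o' := by
        have := pos k hk
        rw [Fin.lt_def] at this ⊢
        rw [Fin.ext_iff] at hk'
        simp [o, o'] at this hk' ⊢
        omega
      exact locNil_trans (b := (Sum.inl o', true)) rfl rfl (by simp) (by simp) (by simp [dual])
        (Or.inl (by simp [dual, ho.ne])) h0 (hu.locNil_inl_of_lt hM hd hlt)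
  have h2 : ∀ k, k ≠ o → LocNil (M.act 0 (root 0 (Sum.inl k, false) (Sum.inl o, true))) :=
    fun k hk => locNil_dual (a := (Sum.inl o, false)) (b := (Sum.inl k, true)) rfl (h1 k hk)
  by_cases hk : k = o
  · rw [hk]
    exact h1 j (by rw [← hk]; exact hkj.symm)
  by_cases hj : j = o
  · rw [hj]
    exact h2 k hk
  exact locNil_trans (b := (Sum.inl o, true)) rfl rfl (by simp) (by simp) (by simp [dual])
    (Or.inl (by simpa [dual] using Ne.symm hk)) (h2 k hk) (hu.locNil_inl_of_lt hM hd (pos j hj))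

theorem IsSingular.locNil_root (hM : M.IsIrreducible) (hu : M.IsSingular (ord m n 0) μ u)
    (hd : IsDominant μ b ν) {c d : BasisIndex m n} (hcd : c ≠ d) :
    LocNil (M.act 0 (root 0 c d)) := by
  by_cases hp : parity c = parity d
  swap
  · exact locNil_of_eq_zero (if_neg (by simpa using hp))
  rcases lt_or_ge (rk (ord m n 0) d) (rk (ord m n 0) c) with hlt | hge
  · exact hu.locNil_of_lt hM hlt
  have hlt : rk (ord m n 0) c < rk (ord m n 0) d :=
    lt_of_le_of_ne hge fun h => hcd (ord_injective (Nat.zero_le m) h)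
  obtain ⟨i | i, s⟩ := c <;> obtain ⟨i' | i', t⟩ := d
  · cases s <;> cases t
    · refine locNil_dual (a := (Sum.inl i', true)) (b := (Sum.inl i, true)) rfl
        (hu.locNil_inl_of_lt hM hd ?_)
      simp [rk, ord] at hlt
      exact hlt
    · by_cases h : i = i'
      · subst h
        exact locNil_of_eq_zero (rootMat_dual_self_eq_zero (b := (Sum.inl i, true)) rfl)
      · exact hu.locNil_inl_neg hM hd h
    · simp [rk, ord] at hlt
      omega
    · refine hu.locNil_inl_of_lt hM hd ?_
      simp [rk, ord] at hlt
      exact hlt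
  · simp [parity, labelParity] at hp
  · simp [parity, labelParity] at hp
  · cases s <;> cases t
    · refine locNil_dual (a := (Sum.inr i', true)) (b := (Sum.inr i, true)) rfl
        (hu.locNil_inr_of_lt hM hd ?_)
      rw [Fin.lt_def]
      simp only [rk, ord, Bool.false_eq_true, if_false] at hlt
      split_ifs at hlt <;> omega
    · exact hu.locNil_inr_neg hM hd i i'
    · simp only [rk, ord, Bool.false_eq_true, if_false, if_true] at hlt
      split_ifs at hlt <;> omega
    · refine hu.locNil_inr_of_lt hM hd ?_
      rw [Fin.lt_def]
      simp only [rk, ord, if_true] at hlt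
      split_ifs at hlt <;> omega

end SuperModule

/-! ### A PBW-type finiteness criterion -/

section FiniteGeneration

variable {V : Type*} [AddCommGroup V] [Module ℂ V] {ι : Type*}

/-- The vector obtained by applying the word `l` in the operators `X` to `v`. -/
def wordVec (X : ι → Module.End ℂ V) (v : V) (l : List ι) : V := l.foldr (fun i w => X i w) v

/-- The span of the vectors obtained from `v` by words of length less than `k`. -/
def wordSpan (X : ι → Module.End ℂ V) (v : V) (k : ℕ) : Submodule ℂ V :=
  Submodule.span ℂ (wordVec X v '' {l | l.length < k})

variable {X : ι → Module.End ℂ V} {v : V}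

theorem wordVec_mem {l : List ι} {k : ℕ} (h : l.length < k) : wordVec X v l ∈ wordSpan X v k :=
  Submodule.subset_span ⟨l, h, rfl⟩

theorem apply_mem_wordSpan (i : ι) {k : ℕ} {w : V} (hw : w ∈ wordSpan X v k) :
    X i w ∈ wordSpan X v (k + 1) := by
  have : wordSpan X v k ≤ (wordSpan X v (k + 1)).comap (X i) := by
    rw [wordSpan, Submodule.span_le]
    rintro _ ⟨l, hl, rfl⟩
    exact wordVec_mem (l := i :: l) (Nat.succ_lt_succ hl)
  exact this hw

theorem wordVec_mem_of_mem (l : List ι) {k : ℕ} {w : V} (hw : w ∈ wordSpan X v k) :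
    wordVec X w l ∈ wordSpan X v (l.length + k) := by
  induction l with
  | nil => simpa [wordVec] using hw
  | cons i l ih =>
    have := apply_mem_wordSpan i ih
    rwa [add_right_comm] at this

/-- Exchanging two letters costs a nonzero scalar and a shorter word, so words may be reordered
modulo shorter ones. -/
theorem wordVec_perm {c : ι → ι → ℂ} (hc : ∀ i j, c i j ≠ 0)
    (hcomm : ∀ i j w, X i (X j w) - c i j • X j (X i w) ∈
      Submodule.span ℂ (Set.range fun k => X k w)) {l l' : List ι} (h : l.Perm l') :
    ∃ ε : ℂ, ε ≠ 0 ∧ wordVec X v l - ε • wordVec X v l' ∈ wordSpan X v l.length := by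
  induction h with
  | nil => exact ⟨1, one_ne_zero, by simp⟩
  | cons i h ih =>
    obtain ⟨ε, h0, hε⟩ := ih
    refine ⟨ε, h0, ?_⟩
    have := apply_mem_wordSpan i hε
    rwa [map_sub, map_smul] at this
  | swap i j l =>
    refine ⟨c j i, hc j i, Submodule.span_le.2 ?_ (hcomm j i (wordVec X v l))⟩
    rintro _ ⟨k, rfl⟩
    exact wordVec_mem (l := k :: l) (by simp)
  | trans h1 h2 ih1 ih2 =>
    obtain ⟨ε, h0, hε⟩ := ih1
    obtain ⟨δ, h0', hδ⟩ := ih2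
    rw [← h1.length_eq] at hδ
    refine ⟨ε * δ, mul_ne_zero h0 h0', ?_⟩
    have := Submodule.add_mem _ hε (Submodule.smul_mem _ ε hδ)
    rwa [smul_sub, smul_smul, sub_add_sub_cancel] at this

/-- A long word repeats some letter often; moved next to v, that power can be rewritten by shorter
words. Hence words of bounded length span a stable subspace containing v, over a finite alphabet. -/
theorem finiteDimensional_of_commutator [Fintype ι] {c : ι → ι → ℂ} (hc : ∀ i j, c i j ≠ 0)
    (hcomm : ∀ i j w, X i (X j w) - c i j • X j (X i w) ∈
      Submodule.span ℂ (Set.range fun k => X k w))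
    (hv : ∀ i, ∃ N : ℕ, (X i ^ N) v ∈ wordSpan X v N)
    (htop : ∀ S : Submodule ℂ V, v ∈ S → (∀ i, ∀ w ∈ S, X i w ∈ S) → S = ⊤) :
    FiniteDimensional ℂ V := by
  classical
  choose N hN using hv
  set K := ∑ i, N i
  have hpow : ∀ i k, wordVec X v (List.replicate k i) = (X i ^ k) v := by
    intro i k
    induction k with
    | zero => rfl
    | succ k ih =>
      rw [pow_succ', Module.End.mul_apply, ← ih]
      rfl
  have hlong : ∀ l : List ι, K < l.length → wordVec X v l ∈ wordSpan X v l.length := by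
    intro l hl
    -- Pigeonhole: otherwise the length would be at most the sum K of the bounds.
    obtain ⟨i, hi⟩ : ∃ i, N i ≤ l.count i := by
      by_contra! H
      refine absurd hl (not_lt.2 ?_)
      rw [← List.sum_toFinset_count_eq_length]
      exact (Finset.sum_le_sum fun i _ => (H i).le).trans
        (Finset.sum_le_sum_of_subset (Finset.subset_univ _))
    obtain ⟨l', hl'⟩ := (List.replicate_sublist_iff.2 hi).exists_perm_append
    have hp := hl'.trans List.perm_append_comm
    obtain ⟨ε, -, hε⟩ := wordVec_perm (v := v) hc hcomm hp
    have h1 : wordVec X v (l' ++ List.replicate (N i) i) ∈ wordSpan X v l.length := by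
      rw [hp.length_eq, List.length_append, List.length_replicate]
      have : wordVec X v (l' ++ List.replicate (N i) i) = wordVec X ((X i ^ N i) v) l' := by
        rw [← hpow, wordVec, List.foldr_append]
        rfl
      rw [this]
      exact wordVec_mem_of_mem l' (hN i)
    have := Submodule.add_mem _ hε (Submodule.smul_mem _ ε h1)
    rwa [sub_add_cancel] at this
  have hstep : wordSpan X v (K + 2) ≤ wordSpan X v (K + 1) := by
    rw [wordSpan, Submodule.span_le]
    rintro _ ⟨l, hl, rfl⟩
    rcases Nat.lt_or_ge l.length (K + 1) with h | h
    · exact wordVec_mem h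
    · have hlen : l.length = K + 1 := le_antisymm (Nat.le_of_lt_succ hl) h
      have := hlong l (by omega)
      rwa [hlen] at this
  have h := htop (wordSpan X v (K + 1)) (wordVec_mem (l := []) (Nat.succ_pos K))
    fun i w hw => hstep (apply_mem_wordSpan i hw)
  have hfin : (wordVec X v '' {l : List ι | l.length < K + 1}).Finite :=
    (List.finite_length_lt ι (K + 1)).image _
  have : FiniteDimensional ℂ (wordSpan X v (K + 1)) := FiniteDimensional.span_of_finite ℂ hfin
  rw [h] at this
  exact Module.Finite.equiv (Submodule.topEquiv (R := ℂ) (M := V))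

end FiniteGeneration

namespace SuperModule

variable {V : Type*} [AddCommGroup V] [Module ℂ V] {M : SuperModule m n V}
  {μ : Weight m n} {u : V} {b : Fin n → ℕ} {ν : Fin m → ℤ}

/-- The operators by which the root vectors and the Cartan subalgebra act. -/
noncomputable def rootOp (M : SuperModule m n V) (i : ZMod 2 × BasisIndex m n × BasisIndex m n) :
    Module.End ℂ V := M.act i.1 (root i.1 i.2.1 i.2.2)

theorem act_mem_span_rootOp (p : ZMod 2) (x : osp m n p) (w : V) :
    M.act p x w ∈ Submodule.span ℂ (Set.range fun k => M.rootOp k w) := by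
  rw [M.act_eq_sum_root]
  exact Submodule.smul_mem _ _ (Submodule.sum_mem _ fun a _ => Submodule.sum_mem _ fun b _ =>
    Submodule.smul_mem _ _ (Submodule.subset_span ⟨(p, a, b), rfl⟩))

theorem root_self (a : BasisIndex m n) : root 0 a a = coroot a := by
  apply Subtype.ext
  rw [coroot_coe]
  refine (rootMat_of (by simp)).trans ?_
  rw [rootSign, superSign_zero_left, one_mul, gsign_mul_self, one_smul]

theorem IsSingular.finiteDimensional (hM : M.IsIrreducible) (hu : M.IsSingular (ord m n 0) μ u)
    (hd : IsDominant μ b ν) : FiniteDimensional ℂ V := by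
  refine finiteDimensional_of_commutator (X := M.rootOp) (v := u)
    (c := fun i j => superSign i.1 j.1) ?_ ?_ ?_ ?_
  · intro i j h
    have := superSign_mul_self i.1 j.1
    rw [h] at this
    simp at this
  · rintro ⟨p, a, b⟩ ⟨q, c, d⟩ w
    simp only [rootOp]
    rw [M.act_act (root p a b) (root q c d) (bracket (root p a b) (root q c d)) rfl rfl,
      add_sub_cancel_right]
    exact act_mem_span_rootOp _ _ w
  · rintro ⟨p, a, d⟩
    obtain rfl | rfl : p = 0 ∨ p = 1 := by
      revert p
      decide
    · by_cases had : a = d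
      · subst had
        refine ⟨1, ?_⟩
        rw [pow_one, rootOp, root_self, hu.hasWt.act_coroot]
        exact Submodule.smul_mem _ _ (wordVec_mem (l := []) Nat.one_pos)
      · obtain ⟨N, hN⟩ := hu.locNil_root hM hd had u
        exact ⟨N, (congrArg (· ∈ _) hN).mpr (Submodule.zero_mem _)⟩
    · refine ⟨2, ?_⟩
      -- For odd x, the square of its action is half the action of [x, x], so x²u lies in the span
      -- of words of length one.
      have h1 := M.act_act (root 1 a d) (root 1 a d) (bracket (root 1 a d) (root 1 a d)) rfl rfl u
      set w := M.act 1 (root 1 a d) (M.act 1 (root 1 a d) u)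
      have h2 : w = (2⁻¹ : ℂ) • M.act (1 + 1) (bracket (root 1 a d) (root 1 a d)) u := by
        rw [eq_sub_of_add_eq h1.symm, superSign_one_one, neg_one_smul, sub_neg_eq_add, ← two_smul ℂ,
          smul_smul]
        norm_num
      have h3 : (M.rootOp (1, a, d) ^ 2) u = w := by
        rw [pow_two]
        rfl
      rw [h3, h2]
      refine Submodule.smul_mem _ _ (Submodule.span_le.2 ?_ (act_mem_span_rootOp _ _ u))
      rintro _ ⟨k, rfl⟩
      exact wordVec_mem (l := [k]) (by simp)
  · intro S huS hS
    rw [eq_top_iff, ← hM.span_eq_top (S := {w | M.Homog w ∧ w ∈ S}) (fun s hs => hs.1)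
      ⟨u, ⟨hu.homog, huS⟩, hu.ne_zero⟩ fun s hs p a b => Submodule.subset_span
        ⟨hs.1.act M p _, hS (p, a, b) s hs.2⟩, Submodule.span_le]
    exact fun s hs => hs.2

end SuperModule

/-! ### Dominant weights and hook partitions -/

/-- The diagram with rows `b_{n-1}, …, b_0` followed by the diagram with columns `|ν_0|, |ν_1|, …`
below. -/
def hookDiagram {μ : Weight m n} {b : Fin n → ℕ} {ν : Fin m → ℤ} (hd : IsDominant μ b ν) :
    YoungDiagram where
  cells := (Finset.univ : Finset (Fin n)).biUnion
      (fun i => (Finset.range (b i)).image fun c => (n - 1 - (i : ℕ), c)) ∪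
    (Finset.univ : Finset (Fin m)).biUnion
      (fun j => (Finset.range (ν j).natAbs).image fun r => (n + r, (j : ℕ)))
  isLowerSet := by
    rintro ⟨r, c⟩ ⟨r', c'⟩ ⟨hr, hc⟩ h
    simp only [Finset.coe_union, Set.mem_union, Finset.mem_coe, Finset.mem_biUnion,
      Finset.mem_univ, true_and, Finset.mem_image, Finset.mem_range, Prod.mk.injEq] at h hr hc ⊢
    rcases h with ⟨i, x, hx, rfl, rfl⟩ | ⟨j, x, hx, rfl, rfl⟩
    · left
      refine ⟨⟨n - 1 - r', by omega⟩, c', ?_, ?_, rfl⟩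
      · rcases Nat.lt_or_ge i (n - 1 - r') with h | h
        · have := hd.mono i ⟨n - 1 - r', by omega⟩ h
          omega
        · have e : (⟨n - 1 - r', by omega⟩ : Fin n) = i := Fin.ext (by simp; omega)
          rw [e]
          omega
      · simp
        omega
    · rcases Nat.lt_or_ge r' n with h | h
      · left
        -- A box of column j below the first n rows means ν_j ≠ 0, so the hook condition makes row n
        -- - 1, of length b_0, reach past column j.
        have h0 : b ⟨0, by omega⟩ > j := by
          by_contra h1
          have := hd.hook ⟨0, by omega⟩ rfl j (not_lt.1 h1)
          omega
        refine ⟨⟨n - 1 - r', by omega⟩, c', ?_, by simp; omega, rfl⟩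
        rcases Nat.eq_zero_or_pos (n - 1 - r') with h2 | h2
        · simp only [h2]
          omega
        · have := hd.mono ⟨0, by omega⟩ ⟨n - 1 - r', by omega⟩ h2
          omega
      · right
        refine ⟨⟨c', by omega⟩, r' - n, ?_, by omega, rfl⟩
        rcases Nat.lt_or_ge c' j with h | h
        · have := hd.anti ⟨c', by omega⟩ j h
          omega
        · have e : (⟨c', by omega⟩ : Fin m) = j := Fin.ext (by simp; omega)
          rw [e]
          omega

theorem mem_hookDiagram {μ : Weight m n} {b : Fin n → ℕ} {ν : Fin m → ℤ} (hd : IsDominant μ b ν)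
    (r c : ℕ) : (r, c) ∈ hookDiagram hd ↔ (∃ i : Fin n, n - 1 - (i : ℕ) = r ∧ c < b i) ∨
      ∃ j : Fin m, (j : ℕ) = c ∧ n ≤ r ∧ r - n < (ν j).natAbs := by
  rw [← YoungDiagram.mem_cells]
  simp only [hookDiagram, Finset.mem_union, Finset.mem_biUnion, Finset.mem_univ, true_and,
    Finset.mem_image, Finset.mem_range, Prod.mk.injEq]
  refine or_congr (exists_congr fun i => ?_) (exists_congr fun j => ?_)
  · constructor
    · rintro ⟨x, hx, h1, rfl⟩
      exact ⟨h1, hx⟩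
    · rintro ⟨h1, hx⟩
      exact ⟨c, hx, h1, rfl⟩
  · constructor
    · rintro ⟨x, hx, rfl, h1⟩
      exact ⟨h1, by omega, by omega⟩
    · rintro ⟨h1, h2, hx⟩
      exact ⟨r - n, hx, by omega, h1⟩

theorem rowLen_hookDiagram {μ : Weight m n} {b : Fin n → ℕ} {ν : Fin m → ℤ}
    (hd : IsDominant μ b ν) (i : Fin n) : (hookDiagram hd).rowLen (n - 1 - i) = b i := by
  refine eq_of_forall_lt_iff fun c => ?_
  rw [← YoungDiagram.mem_iff_lt_rowLen, mem_hookDiagram]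
  constructor
  · rintro (⟨i', h1, h2⟩ | ⟨j, -, h2, -⟩)
    · obtain rfl : i' = i := Fin.ext (by omega)
      exact h2
    · omega
  · exact fun h => Or.inl ⟨i, rfl, h⟩

theorem colLen_hookDiagram {μ : Weight m n} {b : Fin n → ℕ} {ν : Fin m → ℤ}
    (hd : IsDominant μ b ν) (j : Fin m) :
    max (((hookDiagram hd).colLen j : ℤ) - n) 0 = (ν j).natAbs := by
  have h : (hookDiagram hd).colLen j - n = (ν j).natAbs := by
    refine eq_of_forall_lt_iff fun t => ?_
    have h1 : t < (hookDiagram hd).colLen j - n ↔ n + t < (hookDiagram hd).colLen j := by omega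
    rw [h1, ← YoungDiagram.mem_iff_lt_colLen, mem_hookDiagram]
    constructor
    · rintro (⟨i, h1, h2⟩ | ⟨j', h1, h2, h3⟩)
      · omega
      · obtain rfl : j' = j := Fin.ext h1
        omega
    · exact fun h => Or.inr ⟨j, rfl, by omega, by omega⟩
  omega

theorem isHookPartition_hookDiagram {μ : Weight m n} {b : Fin n → ℕ} {ν : Fin m → ℤ}
    (hd : IsDominant μ b ν) : IsHookPartition n m (hookDiagram hd) := by
  refine not_lt.1 fun h => ?_
  rw [← YoungDiagram.mem_iff_lt_rowLen, mem_hookDiagram] at h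
  rcases h with ⟨i, h1, -⟩ | ⟨j, h1, -⟩ <;> omega

theorem IsDominant.exists_hookWeight {μ : Weight m n} {b : Fin n → ℕ} {ν : Fin m → ℤ}
    (hd : IsDominant μ b ν) :
    ∃ (lam : YoungDiagram) (s : ℤˣ), IsHookPartition n m lam ∧ μ = hookWeight m n s lam := by
  have key : ∀ s : ℤˣ, (∀ j : Fin m, (j : ℕ) + 1 = m → (s : ℤ) * (ν j).natAbs = -ν j) →
      ∃ (lam : YoungDiagram) (s : ℤˣ), IsHookPartition n m lam ∧ μ = hookWeight m n s lam := by
    intro s hs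
    refine ⟨hookDiagram hd, s, isHookPartition_hookDiagram hd, ?_⟩
    ext (j | i)
    · rw [hd.inl, hookWeight, colLen_hookDiagram]
      split_ifs with h
      · rw [hs j h]
        push_cast
        rfl
      · have := hd.anti j ⟨j + 1, by omega⟩ (by simp [Fin.lt_def])
        have h1 : ((ν j).natAbs : ℤ) = ν j := by omega
        rw [h1]
        push_cast
        rfl
    · rw [hd.inr, hookWeight, rowLen_hookDiagram]
  -- All ν_j but the last are nonnegative by `anti`, so one sign suffices; if m = 0 the condition is
  -- vacuous.
  by_cases h : ∀ j : Fin m, (j : ℕ) + 1 = m → 0 ≤ ν j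
  · refine key (-1) fun j hj => ?_
    have := h j hj
    simp
    exact this
  · push Not at h
    obtain ⟨j, hj, h⟩ := h
    refine key 1 fun j' hj' => ?_
    obtain rfl : j' = j := Fin.ext (by omega)
    simp
    omega

theorem exists_isDominant_hookWeight (s : ℤˣ) (lam : YoungDiagram) :
    ∃ b ν, IsDominant (hookWeight m n s lam) b ν := by
  refine ⟨fun i => lam.rowLen (n - 1 - i), fun j => if (j : ℕ) + 1 = m then
    -((s : ℤ) * max ((lam.colLen j : ℤ) - n) 0) else max ((lam.colLen j : ℤ) - n) 0,
    fun i => rfl, fun j => ?_, fun i i' hii => ?_, fun j k hjk => ?_, fun i hi j hj => ?_⟩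
  · rw [hookWeight]
    split_ifs <;> simp
  · exact lam.rowLen_anti _ _ (by omega)
  · have h1 := lam.colLen_anti j k (by omega)
    have h2 : (j : ℕ) + 1 ≠ m := by omega
    simp only [if_neg h2]
    rcases Int.units_eq_one_or s with rfl | rfl <;> split_ifs <;> simp <;> omega
  -- A box (n, j) would force the box (n - 1, j) above it, hence j < `lam.rowLen (n - 1)` = b_0.
  · have h1 : ((lam.colLen j : ℤ) - n) ≤ 0 := by
      by_contra h1
      have h2 : n < lam.colLen j := by omega
      rw [← YoungDiagram.mem_iff_lt_colLen] at h2
      have h3 := YoungDiagram.up_left_mem lam (i1 := n - 1 - i) (by omega) le_rfl h2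
      rw [YoungDiagram.mem_iff_lt_rowLen] at h3
      omega
    simp [max_eq_right h1]

end OrthoSymplectic

theorem mainTheorem10 (m n : ℕ) {V : Type*} [AddCommGroup V] [Module ℂ V]
    (M : OrthoSymplectic.SuperModule m n V) (hM : M.IsIrreducible)
    (μ : OrthoSymplectic.Weight m n) (hμ : OrthoSymplectic.IsIntegral μ)
    (hw : M.HasHighestWeight μ) :
    FiniteDimensional ℂ V ↔
      ∃ (lam : YoungDiagram) (s : ℤˣ), OrthoSymplectic.IsHookPartition n m lam ∧
        μ = OrthoSymplectic.hookWeight m n s lam := by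
  obtain ⟨u, hu⟩ := hw.exists_isSingular
  constructor
  · intro _
    obtain ⟨b, ν, hd⟩ := hu.exists_isDominant hμ
    exact hd.exists_hookWeight
  · rintro ⟨lam, s, -, rfl⟩
    obtain ⟨b, ν, hd⟩ := OrthoSymplectic.exists_isDominant_hookWeight (m := m) (n := n) s lam
    exact hu.finiteDimensional hM hd
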